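/- An overpartition is a finite multiset of positive integers (parts) in which, for each integer $a$ that occurs, at most one occurrence of $a$ may be overlined. Write it as $\lambda=(\lambda_1,\dots,\lambda_\ell)$ with $\lambda_1\le\dots\le\lambda_\ell$ in the order $\overline1<1<\overline2<2<\cdots$. Let $|\lambda_j|$ be the size of the part $\lambda_j$, $|\lambda|=\sum_j|\lambda_j|$, and let $f_a(\lambda)$ (resp. $f_{\overline a}(\lambda)$) be the number of non-overlined (resp. overlined) parts of size $a$. The Göllnitz–Gordon marking of $\lambda$ assigns positive integers (marks) to $\lambda_1,\lambda_2,\dots,\lambda_\ell$ successively. The part $\lambda_1$ gets the mark $1$. For $p>1$: (1) if $\lambda_p$ is a non-overlined odd part or an overlined even part, it gets the mark $1$; (2) if $\lambda_p$ is an overlined odd part, it gets the least positive integer that is not the mark of any $\lambda_j$, $j<p$, with $|\lambda_p|-|\lambda_j|=1$; (3) if $\lambda_p=2t+2$ is a non-overlined even part, let $f$ be the least positive integer that is not the mark of any $\lambda_j$, $j<p$, with $|\lambda_p|-|\lambda_j|\le2$, and let $g$ be the least mark of the parts $\lambda_j$, $j<p$, with $|\lambda_p|-|\lambda_j|=2$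 ($g=0$ if there are none). If $g\ge2$, the mark of $\lambda_{p-1}$ is $g-1$, at least one of $2t+1$, $\overline{2t+2}$ occurs in $\lambda$, and $\overline{2t+1}$ does not occur in $\lambda$, then $\lambda_p$ gets the mark $g$; otherwise it gets the mark $f$. Let $k\ge i\ge1$ and $N_1\ge N_2\ge\dots\ge N_{k-1}\ge0$ be integers, and put $N_r=0$ for $r\ge k$ (so $N_1=0$ if $k=1$). Let $\mathbb F_{N_1,\dots,N_{k-1};i}$ be the set of overpartitions $\lambda$ such that (a) $f_{\overline1}(\lambda)+f_2(\lambda)\le i-1$; (b) $f_{\overline{2t}}(\lambda)+f_{2t}(\lambda)+f_{\overline{2t+1}}(\lambda)+f_{2t+2}(\lambda)\le k-1$ for all $t\ge0$ (with $f_0=f_{\overline0}=0$); (c) for all $t\ge0$, if $f_{2t+1}(\lambda)\ge1$ then $f_{2t+2}(\lambda)\le k-2$; (d) the smallest part $\lambda_1$, if $\lambda$ is not empty, is an overlined odd part or a non-overlined even part; (e) for $1\le r\le k-1$, exactly $N_r$ parts of $\lambda$ have the mark $r$. Let $\mathbb G_{N_1,\dots,N_{k-1};i}$ be the set of those $\lambda\in\mathbb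 F_{N_1,\dots,N_{k-1};i}$ that have no overlined even part and no non-overlined odd part. For an integer $M$, let $\mathbb R_M$ be the set of partitions $\tau$ into distinct negative even parts lying in $[-2M,-2]$ (only the empty partition if $M\le0$), and let $|\tau|$ be the sum of the parts of $\tau$. Theorem. There is a bijection $\Phi:\mathbb F_{N_1,\dots,N_{k-1};i}\to\mathbb R_{N_1-1}\times\mathbb G_{N_1,\dots,N_{k-1};i}$ such that $|\lambda|=|\tau|+|\mu|$ whenever $\Phi(\lambda)=(\tau,\mu)$. Moreover, as formal Laurent series in $q$, $$\sum_{\lambda\in\mathbb F_{N_1,\dots,N_{k-1};i}}q^{|\lambda|}=(-q^{2-2N_1};q^2)_{N_1-1}\sum_{\mu\in\mathbb G_{N_1,\dots,N_{k-1};i}}q^{|\mu|},$$ where $(a;b)_n=\prod_{j=0}^{n-1}(1-ab^j)$, and where for $N_1=0$ the factor $(-q^{2-2N_1};q^2)_{N_1-1}$ is read as the empty product $1$. -/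

import Mathlib

namespace GollnitzGordon

/-- A part of an overpartition: a size, together with the information whether it is overlined. -/
structure OPart where
  size : ℕ
  overlined : Bool
  deriving DecidableEq

/-- The overlined part of size `a`. -/
def ov (a : ℕ) : OPart := ⟨a, true⟩

/-- The non-overlined part of size `a`. -/
def pl (a : ℕ) : OPart := ⟨a, false⟩

/-- The position of a part in the order `1̄ < 1 < 2̄ < 2 < ⋯`. -/
def OPart.rank (x : OPart) : ℕ := 2 * x.size + (if x.overlined then 0 else 1)

/-- An overpartition `(λ₁, …, λ_ℓ)`: positive parts, listed in weakly increasing order with respect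
to `1̄ < 1 < 2̄ < 2 < ⋯`, where at most one part of each size is overlined. -/
@[ext]
structure Overpartition where
  parts : List OPart
  pos : ∀ x ∈ parts, 0 < x.size
  sorted : parts.Pairwise (fun x y => x.rank ≤ y.rank)
  count_overlined_le_one : ∀ a : ℕ, parts.count (ov a) ≤ 1

/-- `|λ|`, the sum of the sizes of the parts. -/
def Overpartition.size (lam : Overpartition) : ℕ := (lam.parts.map OPart.size).sum

/-- The number of occurrences of the part `x` in `lam`. -/
def Overpartition.freq (lam : Overpartition) (x : OPart) : ℕ := lam.parts.count x

/-- Overlined odd parts and non-overlined even parts. -/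
def OPart.OddOvOrEvenPl (x : OPart) : Prop :=
  (Odd x.size ∧ x.overlined = true) ∨ (Even x.size ∧ x.overlined = false)

theorem exists_unused (l : List ℕ) : ∃ s, 1 ≤ s ∧ s ∉ l := by
  obtain ⟨s, hs⟩ := Infinite.exists_notMem_finset (insert 0 l.toFinset)
  simp only [Finset.mem_insert, List.mem_toFinset, not_or] at hs
  exact ⟨s, by omega, hs.2⟩

/-- The least positive integer that does not occur in `l`. -/
def leastUnused (l : List ℕ) : ℕ := Nat.find (exists_unused l)

/-- The least element of `l`, or `0` if `l` is empty. -/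
def leastUsed (l : List ℕ) : ℕ := l.min?.getD 0

/-- The marks of those entries of a list of marked parts whose part satisfies `P`. -/
def marksWhere (prev : List (OPart × ℕ)) (P : OPart → Prop) [DecidablePred P] : List ℕ :=
  (prev.filter (fun y => decide (P y.1))).map Prod.snd

/-- The Göllnitz-Gordon mark of the part `x = λ_p` of `lam`, where `prev` is the list of the marked
parts `λ_{p-1}, …, λ_1` (the most recent one first). -/
def nextMark (lam : List OPart) (prev : List (OPart × ℕ)) (x : OPart) : ℕ :=
  if prev = [] then 1
  else if Odd x.size ∧ x.overlined = false then 1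
  else if Even x.size ∧ x.overlined = true then 1
  else if Odd x.size then leastUnused (marksWhere prev (fun y => y.size + 1 = x.size))
  else
    let f := leastUnused (marksWhere prev (fun y => x.size ≤ y.size + 2))
    let g := leastUsed (marksWhere prev (fun y => y.size + 2 = x.size))
    if 2 ≤ g ∧ prev.head?.map Prod.snd = some (g - 1) ∧
        (pl (x.size - 1) ∈ lam ∨ ov x.size ∈ lam) ∧ ov (x.size - 1) ∉ lam
    then g else f

/-- The Göllnitz-Gordon marking of an overpartition: its parts are marked from the smallest to the
largest. The marked parts are returned as a list from the largest to the smallest. -/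
def Overpartition.marking (lam : Overpartition) : List (OPart × ℕ) :=
  lam.parts.foldl (fun prev x => (x, nextMark lam.parts prev x) :: prev) []

/-- The number of `r`-marked parts in the Göllnitz-Gordon marking of `lam`. -/
def Overpartition.numMarked (lam : Overpartition) (r : ℕ) : ℕ :=
  (lam.marking.map Prod.snd).count r

/-- The overpartitions with `f_{1̄} + f_2 ≤ i - 1`, with
`f_{2t̄} + f_{2t} + f_{(2t+1)‾} + f_{2t+2} ≤ k - 1` for all `t`, and with `f_{2t+2} ≤ k - 2` whenever
`f_{2t+1} ≥ 1`. The subtractions (in `ℤ`) are moved to the left-hand sides. -/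
def setO (k i : ℕ) : Set Overpartition :=
  {lam | lam.freq (ov 1) + lam.freq (pl 2) + 1 ≤ i ∧
    (∀ t : ℕ, lam.freq (ov (2 * t)) + lam.freq (pl (2 * t)) + lam.freq (ov (2 * t + 1)) +
      lam.freq (pl (2 * t + 2)) + 1 ≤ k) ∧
    (∀ t : ℕ, 1 ≤ lam.freq (pl (2 * t + 1)) → lam.freq (pl (2 * t + 2)) + 2 ≤ k)}

/-- The set `𝔽_{N₁,…,N_{k-1};i}`: the members of `setO k i` whose smallest part (if there is one) is
an overlined odd part or a non-overlined even part and which have exactly `N r` parts that are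
marked with `r`, for `1 ≤ r ≤ k - 1`. -/
def setF (k i : ℕ) (N : ℕ → ℕ) : Set Overpartition :=
  {lam | lam ∈ setO k i ∧ (∀ x ∈ lam.parts.head?, x.OddOvOrEvenPl) ∧
    ∀ r, 1 ≤ r → r < k → lam.numMarked r = N r}

/-- The set `𝔾_{N₁,…,N_{k-1};i}`: the members of `setF k i N` without overlined even parts and
without non-overlined odd parts. -/
def setG (k i : ℕ) (N : ℕ → ℕ) : Set Overpartition :=
  {lam | lam ∈ setF k i N ∧
    (∀ x ∈ lam.parts, ¬ (Even x.size ∧ x.overlined = true)) ∧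
    (∀ x ∈ lam.parts, ¬ (Odd x.size ∧ x.overlined = false))}

/-- The set `ℝ_M` of partitions into distinct negative even parts lying in `[-2M, -2]`; such a
partition is the finite set of its parts. For `M ≤ 0` only the empty partition remains. -/
def setR (M : ℤ) : Set (Finset ℤ) :=
  {τ | ∀ x ∈ τ, Even x ∧ -2 * M ≤ x ∧ x ≤ -2}

/-- There are only finitely many overpartitions of `n`, so that the cardinalities in `genFun` are
true cardinalities. -/
theorem finite_size_eq (n : ℕ) : {lam : Overpartition | lam.size = n}.Finite := by
  have hfin : {l : List (Fin (n + 1) × Bool) | l.length ≤ n}.Finite := List.finite_length_le _ n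
  have himg := hfin.image (fun l => l.map (fun y => (⟨(y.1 : ℕ), y.2⟩ : OPart)))
  refine Set.Finite.of_finite_image (f := Overpartition.parts) (himg.subset ?_)
    (fun a _ b _ h => Overpartition.ext h)
  rintro _ ⟨lam, hl, rfl⟩
  have hsum : (lam.parts.map OPart.size).sum = n := hl
  refine ⟨lam.parts.map (fun x => (Fin.ofNat (n + 1) x.size, x.overlined)), ?_, ?_⟩
  · have h := List.card_nsmul_le_sum (lam.parts.map OPart.size) 1 (by
      intro y hy
      obtain ⟨x, hx, rfl⟩ := List.mem_map.1 hy
      exact lam.pos x hx)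
    simp only [List.length_map, smul_eq_mul, mul_one] at h
    simp only [Set.mem_ofPred_eq, List.length_map]
    omega
  · simp only [List.map_map]
    conv_rhs => rw [← List.map_id lam.parts]
    refine List.map_congr_left (fun x hx => ?_)
    have h1 : x.size ≤ n := by
      rw [← hsum]
      exact List.single_le_sum (by simp) _ (List.mem_map_of_mem hx)
    have h2 : x.size % (n + 1) = x.size := Nat.mod_eq_of_lt (by omega)
    cases x
    simp_all [Fin.ofNat]

/-- The generating function `∑_{λ ∈ S} q^{|λ|}`, as a formal Laurent series in `q`. -/
noncomputable def genFun (S : Set Overpartition) : LaurentSeries ℤ :=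
  HahnSeries.ofPowerSeries ℤ ℤ
    (PowerSeries.mk fun n => (({lam ∈ S | lam.size = n}.ncard : ℕ) : ℤ))

/-- The monomial `q ^ e`, `e ∈ ℤ`, as a formal Laurent series in `q`. -/
noncomputable def qpow (e : ℤ) : LaurentSeries ℤ := HahnSeries.single e 1

/-- The `q`-shifted factorial `(a; b)_n = (1 - a) (1 - a b) ⋯ (1 - a b ^ (n - 1))`. -/
def qPoch {A : Type*} [CommRing A] (a b : A) (n : ℕ) : A :=
  ∏ j ∈ Finset.range n, (1 - a * b ^ j)

end GollnitzGordon

/-!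
Call a part of an overpartition good if it is an overlined odd or a non-overlined even part, and bad
otherwise. Bad parts always get the mark `1`. The number of parts with marks up to `r` is the number
of parts kept by the greedy scan from the smallest part that keeps all bad parts and keeps a good
part as long as the conditions of `setO (r + 1)` remain satisfied
(`Overpartition.kept_eq_sum_numMarked`). The exceptional case in the definition of the marking is
just what makes this true: if a bad part lies between the parts `2t` and `2t + 2`, but no part `2t`
and no good part `2t + 1` has the mark `1`, then the mark `1` is blocked for the parts `2t + 2` in
exchange for the least mark of the parts `2t` (`exceptional_mark`).
Hence `setF k i N` can be described by frequencies and by the results `Conf.kept` of these scans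
(`mem_setF_iff`).

The bijection makes the bad parts good one by one, the largest first. In each step the largest bad
part and all larger parts with mark `1`, say `p` parts, move up by `2`, and the bad part becomes
good (`Conf.Shift`). So the size grows by `2p`, which is compensated by the negative part `-2p`.
The step is invertible: the parts moved are selected greedily from below, and their images are the
`p` largest parts among those selected greedily from above. Both selections are described by the
same local conditions, which are the fields of `Conf.Shift`. The step also preserves the results of
all greedy scans: two scans of the same capacity through the overpartitions before and after the
step keep in step up to at most one part (`Conf.Shift.couple`).

Let `setS m` consist of the overpartitions all of whose bad parts are among the first `m` parts with
mark `1`. A step with `p = N 1 - m` is a bijection from `setS (m + 1) \ setS m` to `setS m`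
(`exists_equiv_diff`), and, apart from trivial cases, `setF` and `setG` are `setS (N 1)` and
`setS 1`, because the smallest part is good and has the mark `1`. Composing the steps for
`m = N 1 - 1, …, 1` gives both the bijection and the product formula.
-/

namespace GollnitzGordon

/-! ### Frequencies, greedy scans and the moving of parts -/

/-- The frequencies of the parts of an overpartition: `E t`, `e t`, `O t` and `P t` are the numbers
of parts `2t`, `2t` overlined, `2t + 1` overlined and `2t + 1`, respectively. Thus `E` and `O`
record the parts allowed in `setG`, while `e` and `P` record the others, called bad below. -/
@[ext]
structure Conf where
  E : ℕ → ℕ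
  e : ℕ → ℕ
  O : ℕ → ℕ
  P : ℕ → ℕ

namespace Conf

/-- The number of parts `2t` that are kept when, scanning from the smallest part, every bad part is
kept, and a good part is kept as long as the conditions of `setO (r + 1)` remain satisfied. There
are no parts of size `0`. -/
def keptE (c : Conf) (r : ℕ) : ℕ → ℕ
  | 0 => 0
  | t + 1 => min (c.E (t + 1)) (min (r - c.e (t + 1))
      (r - max (c.e t + keptE c r t + min (c.O t) (r - (c.e t + keptE c r t))) (min 1 (c.P t))))

/-- The number of overlined parts `2t + 1` that are kept in the scan of `Conf.keptE`. -/
def keptO (c : Conf) (r t : ℕ) : ℕ := min (c.O t) (r - (c.e t + c.keptE r t))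

theorem keptE_zero (c : Conf) (r : ℕ) : c.keptE r 0 = 0 := rfl

theorem keptE_succ (c : Conf) (r t : ℕ) : c.keptE r (t + 1) = min (c.E (t + 1))
    (min (r - c.e (t + 1)) (r - max (c.e t + c.keptE r t + c.keptO r t) (min 1 (c.P t)))) := rfl

/-- The number of parts of size less than `2T` that are kept in the scan of capacity `r`. -/
def kept (c : Conf) (r T : ℕ) : ℕ :=
  ∑ t ∈ Finset.range T, (c.e t + c.P t + c.keptE r t + c.keptO r t)

theorem kept_succ (c : Conf) (r T : ℕ) : c.kept r (T + 1) =
    c.kept r T + (c.e T + c.P T + c.keptE r T + c.keptO r T) :=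
  Finset.sum_range_succ _ _

/-- All parts have size less than `2K`. -/
def Below (c : Conf) (K : ℕ) : Prop := ∀ t, K ≤ t → c.E t = 0 ∧ c.e t = 0 ∧ c.O t = 0 ∧ c.P t = 0

/-- The sum of the parts of size less than `2T`. -/
def weight (c : Conf) (T : ℕ) : ℕ :=
  ∑ t ∈ Finset.range T, (2 * t * (c.E t + c.e t) + (2 * t + 1) * (c.O t + c.P t))

/-- The number of parts of size less than `2T`. -/
def card (c : Conf) (T : ℕ) : ℕ :=
  ∑ t ∈ Finset.range T, (c.E t + c.e t + c.O t + c.P t)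

/-- `c'` arises from `c` by moving some parts up by `2`. The moved parts are the bad part `2t₀ + 1`
or `2t₀ + 2` (overlined), which becomes good, and all larger parts that carry the mark `1`; the
other parts are all good from there on. Here `aE t` and `aO t` count the moved parts of size `2t`
and `2t + 1`, and `gE t` and `gO t` the unmoved good parts. The conditions `excl`, `full` and `odd`
express at the same time that the moved parts are selected in `c` by the greedy scan from below and
that their images are selected in `c'` by the greedy scan from above. -/
structure Shift (t₀ : ℕ) (gE gO aE aO : ℕ → ℕ) (c c' : Conf) : Prop where
  aE_low : ∀ t, t ≤ t₀ → aE t = 0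
  aO_low : ∀ t, t < t₀ → aO t = 0
  start : aO t₀ + aE (t₀ + 1) = 1
  excl : ∀ t, t₀ ≤ t → aE t + aO t + aE (t + 1) ≤ 1
  full : ∀ t, t₀ ≤ t → 0 < gE (t + 1) → aE t + aO t + aE (t + 1) = 1
  odd : ∀ t, t₀ < t → gO t ≤ aE t
  E_eq : ∀ t, t ≠ t₀ + 1 → c.E t = gE t + aE t
  E_start : c.E (t₀ + 1) = gE (t₀ + 1)
  O_eq : ∀ t, t ≠ t₀ → c.O t = gO t + aO t
  O_start : c.O t₀ = gO t₀
  e_eq : ∀ t, t ≠ t₀ + 1 → c.e t = c'.e t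
  e_start : c.e (t₀ + 1) = c'.e (t₀ + 1) + aE (t₀ + 1)
  P_eq : ∀ t, t ≠ t₀ → c.P t = c'.P t
  P_start : c.P t₀ = c'.P t₀ + aO t₀
  E_zero' : c'.E 0 = gE 0
  E_succ' : ∀ t, c'.E (t + 1) = gE (t + 1) + aE t
  O_zero' : c'.O 0 = gO 0
  O_succ' : ∀ t, c'.O (t + 1) = gO (t + 1) + aO t
  e_high : ∀ t, t₀ < t → c'.e t = 0
  P_high : ∀ t, t₀ < t → c'.P t = 0

namespace Shift

variable {t₀ : ℕ} {gE gO aE aO : ℕ → ℕ} {c c' : Conf}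

theorem E_low (h : Shift t₀ gE gO aE aO c c') {t : ℕ} (ht : t ≤ t₀ + 1) : c'.E t = c.E t := by
  have h1 := h.E_start
  rcases t with _ | t
  · rw [h.E_zero', h.E_eq 0 (by omega), h.aE_low 0 (by omega), add_zero]
  · have h2 := h.E_succ' t
    have h3 := h.aE_low t (by omega)
    have h4 := h.E_eq (t + 1)
    have h5 := h.aE_low (t + 1)
    by_cases ht' : t = t₀
    · subst ht'; omega
    · have := h4 (by omega)
      have := h5 (by omega)
      omega

theorem O_low (h : Shift t₀ gE gO aE aO c c') {t : ℕ} (ht : t ≤ t₀) : c'.O t = c.O t := by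
  have h1 := h.O_start
  have h4 := h.O_eq t
  have h5 := h.aO_low t
  have h6 : c'.O t = gO t := by
    rcases t with _ | t
    · exact h.O_zero'
    · rw [h.O_succ' t, h.aO_low t (by omega), add_zero]
  by_cases ht' : t = t₀
  · subst ht'; omega
  · have := h4 ht'
    have := h5 (by omega)
    omega

theorem keptE_low (h : Shift t₀ gE gO aE aO c c') (r : ℕ) :
    ∀ t, t ≤ t₀ → c'.keptE r t = c.keptE r t := by
  intro t
  induction t with
  | zero => intro _; rfl
  | succ t ih =>
    intro ht
    have h1 := ih (by omega)
    have h2 := h.E_low (t := t + 1) (by omega)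
    have h3 := h.O_low (t := t) (by omega)
    have h4 := h.e_eq t (by omega)
    have h5 := h.e_eq (t + 1) (by omega)
    have h6 := h.P_eq t (by omega)
    rw [keptE_succ, keptE_succ, keptO, keptO, h1, h2, h3, h4, h5, h6]

theorem keptO_low (h : Shift t₀ gE gO aE aO c c') (r : ℕ) {t : ℕ} (ht : t ≤ t₀) :
    c'.keptO r t = c.keptO r t := by
  rw [keptO, keptO, h.keptE_low r t ht, h.O_low ht, h.e_eq t (by omega)]

theorem kept_low (h : Shift t₀ gE gO aE aO c c') (r : ℕ) {T : ℕ} (hT : T ≤ t₀) :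
    c'.kept r T = c.kept r T := by
  refine Finset.sum_congr rfl fun t ht => ?_
  have ht' := Finset.mem_range.1 ht
  rw [h.keptE_low r t (by omega), h.keptO_low r (by omega), h.e_eq t (by omega),
    h.P_eq t (by omega)]

theorem kept_start (h : Shift t₀ gE gO aE aO c c') (r : ℕ) :
    c.kept r (t₀ + 1) = c'.kept r (t₀ + 1) + aO t₀ := by
  have h1 := h.kept_low r le_rfl
  have h2 := h.keptE_low r t₀ le_rfl
  have h3 := h.keptO_low r (le_refl t₀)
  have h4 := h.e_eq t₀ (by omega)
  have h5 := h.P_start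
  rw [kept_succ, kept_succ]
  omega

set_option maxHeartbeats 1000000 in
/-- The greedy scans of capacity `r` through `c` and `c'` keep in step: up to any even size they
have kept the same number of parts, or the scan of `c` is one part ahead. Which of the two is the
case is tied to the numbers of parts kept at the last even size and to the parts moved. -/
theorem couple (h : Shift t₀ gE gO aE aO c c') {r : ℕ} (hr : 1 ≤ r) (s : ℕ) :
    ∃ l l' X X', l = c.e (t₀ + 1 + s) + c.keptE r (t₀ + 1 + s) ∧
      l' = c'.e (t₀ + 1 + s) + c'.keptE r (t₀ + 1 + s) ∧
      X = c.kept r (t₀ + 1 + s) + l ∧ X' = c'.kept r (t₀ + 1 + s) + l' ∧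
      ((aE (t₀ + 1 + s) = 0 ∧ aO (t₀ + s) = 0 ∧ X = X' ∧
          (l' = l + 1 ∧ l' ≤ r ∨ l = 0 ∧ l' = 0)) ∨
        (aE (t₀ + 1 + s) = 0 ∧ aO (t₀ + s) = 1 ∧
          (X = X' + 1 ∧ l = l' ∧ l + 1 ≤ r ∨ X = X' ∧ l + 1 = r ∧ l' = r)) ∨
        (aE (t₀ + 1 + s) = 1 ∧ aO (t₀ + s) = 0 ∧
          (X = X' ∧ l = r ∧ l' = r ∨ X = X' + 1 ∧ l = l' + 1 ∧ l ≤ r))) := by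
  refine ⟨_, _, _, _, rfl, rfl, rfl, rfl, ?_⟩
  induction s with
  | zero =>
    have h0 := h.start
    have h1 := h.kept_start r
    have h7 := h.e_high (t₀ + 1) (by omega)
    have h6 : c.e (t₀ + 1) = aE (t₀ + 1) := by rw [h.e_start, h7, zero_add]
    obtain ⟨w, hw⟩ : ∃ w, w = c.e t₀ + c.keptE r t₀ + c.keptO r t₀ := ⟨_, rfl⟩
    have h9 : c.keptE r (t₀ + 1) = min (c.E (t₀ + 1))
        (min (r - aE (t₀ + 1)) (r - max w (min 1 (c'.P t₀ + aO t₀)))) := by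
      rw [keptE_succ, h6, ← hw, h.P_start]
    have h10 : c'.keptE r (t₀ + 1) = min (c.E (t₀ + 1)) (r - max w (min 1 (c'.P t₀))) := by
      rw [keptE_succ, h.keptE_low r t₀ le_rfl, h.keptO_low r (le_refl t₀), h7,
        ← h.e_eq t₀ (by omega), ← hw, h.E_low le_rfl]
      omega
    have h11 : w ≤ r ∨ r < w := le_or_gt _ _
    rw [add_zero, add_zero, h6, h7, h1]
    clear hw h1 h6 h7
    generalize c.keptE r (t₀ + 1) = x3 at *
    generalize c'.keptE r (t₀ + 1) = x4 at *
    generalize c'.P t₀ = p at *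
    generalize c.E (t₀ + 1) = n at *
    generalize aE (t₀ + 1) = a1 at *
    generalize aO t₀ = a2 at *
    have k : a1 = 0 ∧ a2 = 1 ∨ a1 = 1 ∧ a2 = 0 := by omega
    rcases k with ⟨k1, k3⟩ | ⟨k1, k3⟩ <;> subst k1 k3
    · right; left; omega
    · right; right; omega
  | succ s ih =>
    obtain ⟨t, ht⟩ : ∃ t, t = t₀ + 1 + s := ⟨_, rfl⟩
    have e1 : t₀ + 1 + (s + 1) = t + 1 := by omega
    have e2 : t₀ + (s + 1) = t := by omega
    rw [← ht] at ih
    rw [e1, e2]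
    have h1 : c'.O t = gO t + aO (t₀ + s) := by
      have := h.O_succ' (t₀ + s)
      rwa [show t₀ + s + 1 = t by omega] at this
    have h2 := h.O_eq t (by omega)
    have h3 := h.E_succ' t
    have h4 := h.E_eq (t + 1) (by omega)
    have h5 := h.excl t (by omega)
    have h6 := h.full t (by omega)
    have h7 := h.odd t (by omega)
    have h8 := h.e_high t (by omega)
    have h9 := h.e_high (t + 1) (by omega)
    have h10 := h.P_high t (by omega)
    have h11 := h.P_eq t (by omega)
    have h12 := h.e_eq (t + 1) (by omega)
    have h13 : c.keptE r (t + 1) = min (gE (t + 1) + aE (t + 1))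
        (r - (c.e t + c.keptE r t + c.keptO r t)) := by
      rw [keptE_succ, h4, h11, h10, h12, h9]; omega
    have h14 : c'.keptE r (t + 1) = min (gE (t + 1) + aE t)
        (r - (c'.e t + c'.keptE r t + c'.keptO r t)) := by
      rw [keptE_succ, h3, h10, h9]; omega
    have h15 := kept_succ c r t
    have h16 := kept_succ c' r t
    have h17 : c.keptO r t = min (gO t + aO t) (r - (c.e t + c.keptE r t)) := by rw [keptO, h2]
    have h18 : c'.keptO r t = min (gO t + aO (t₀ + s)) (r - (c'.e t + c'.keptE r t)) := by
      rw [keptO, h1]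
    clear h1 h2 h3 h4 ht e1 e2
    rw [h11, h10] at h15
    rw [h8, h10] at h16
    rw [h12, h9]
    clear h9 h10 h11 h12
    generalize c.keptO r t = x1 at *
    generalize c'.keptO r t = x2 at *
    generalize c.keptE r (t + 1) = x3 at *
    generalize c'.keptE r (t + 1) = x4 at *
    generalize c.e t + c.keptE r t = x5 at *
    generalize c.kept r t = y5 at *
    generalize c'.kept r t = y6 at *
    generalize gE (t + 1) = g1 at *
    generalize gO t = g2 at *
    generalize aE (t + 1) = a1 at *
    generalize aO t = a2 at *
    generalize aE t = a3 at *
    generalize aO (t₀ + s) = a4 at *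
    -- in each state, the scans keep a definite number of odd parts, and the parts moved next
    -- decide about the new state
    have k1 : a1 = 0 ∧ a2 = 0 ∨ a1 = 0 ∧ a2 = 1 ∨ a1 = 1 ∧ a2 = 0 := by omega
    rcases ih with ⟨i1, i2, i3, i4⟩ | ⟨i1, i2, i3⟩ | ⟨i1, i2, i3⟩
    · have k2 : g2 = 0 := by omega
      have k5 : x1 = a2 := by omega
      have k6 : x2 = 0 := by omega
      subst i1 i2 k2 k5 k6
      clear h17 h18
      rcases k1 with ⟨k1, k3⟩ | ⟨k1, k3⟩ | ⟨k1, k3⟩ <;> subst k1 k3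
      · left; omega
      · right; left; omega
      · right; right; omega
    · have k2 : g2 = 0 := by omega
      have k5 : x1 = a2 := by omega
      subst i1 i2 k2 k5
      clear h17
      rcases i3 with i3 | i3
      · have k6 : x2 = 1 := by omega
        subst k6
        clear h18
        rcases k1 with ⟨k1, k3⟩ | ⟨k1, k3⟩ | ⟨k1, k3⟩ <;> subst k1 k3
        · left; omega
        · right; left; omega
        · right; right; omega
      · have k6 : x2 = 0 := by omega
        subst k6
        clear h18
        rcases k1 with ⟨k1, k3⟩ | ⟨k1, k3⟩ | ⟨k1, k3⟩ <;> subst k1 k3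
        · left; omega
        · right; left; omega
        · right; right; omega
    · have k2 : a1 = 0 ∧ a2 = 0 := by omega
      obtain ⟨k1, k3⟩ := k2
      subst i1 i2 k1 k3
      left
      rcases i3 with i3 | i3
      · have k5 : x1 = 0 := by omega
        have k6 : x2 = 0 := by omega
        subst k5 k6
        omega
      · have k6 : x2 = g2 := by omega
        subst k6
        have k4 : x2 = 0 ∨ x2 = 1 := by omega
        rcases k4 with rfl | rfl <;> omega

end Shift
end Conf

/-! ### Invariants and uniqueness of the moves -/

namespace Conf

theorem kept_of_below {c : Conf} {K : ℕ} (hK : c.Below K) (r : ℕ) {T : ℕ} (hT : K ≤ T) :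
    c.kept r T = c.kept r K := by
  induction T, hT using Nat.le_induction with
  | base => rfl
  | succ T hT ih =>
    obtain ⟨h1, h2, h3, h4⟩ := hK T hT
    have h5 : c.keptE r T = 0 := by
      rcases T with _ | T
      · rfl
      · rw [keptE_succ]; omega
    have h6 : c.keptO r T = 0 := by rw [keptO]; omega
    rw [kept_succ]; omega

theorem card_of_below {c : Conf} {K : ℕ} (hK : c.Below K) {T : ℕ} (hT : K ≤ T) :
    c.card T = c.card K := by
  induction T, hT using Nat.le_induction with
  | base => rfl
  | succ T hT ih =>
    obtain ⟨h1, h2, h3, h4⟩ := hK T hT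
    have : c.card (T + 1) = c.card T + (c.E T + c.e T + c.O T + c.P T) :=
      Finset.sum_range_succ _ _
    omega

theorem weight_of_below {c : Conf} {K : ℕ} (hK : c.Below K) {T : ℕ} (hT : K ≤ T) :
    c.weight T = c.weight K := by
  induction T, hT using Nat.le_induction with
  | base => rfl
  | succ T hT ih =>
    obtain ⟨h1, h2, h3, h4⟩ := hK T hT
    have : c.weight (T + 1) = c.weight T +
        (2 * T * (c.E T + c.e T) + (2 * T + 1) * (c.O T + c.P T)) :=
      Finset.sum_range_succ _ _
    rw [this, ih, h1, h2, h3, h4]; rfl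

theorem kept_mono (c : Conf) (r : ℕ) {S T : ℕ} (h : S ≤ T) : c.kept r S ≤ c.kept r T :=
  Finset.sum_le_sum_of_subset (Finset.range_mono h)

/-- The frequencies that come from an overpartition. -/
structure Proper (c : Conf) : Prop where
  E_zero : c.E 0 = 0
  e_zero : c.e 0 = 0
  e_le : ∀ t, c.e t ≤ 1
  O_le : ∀ t, c.O t ≤ 1
  below : ∃ K, c.Below K

namespace Shift

variable {t₀ : ℕ} {gE gO aE aO : ℕ → ℕ} {c c' : Conf}

theorem lt_of_below (h : Shift t₀ gE gO aE aO c c') {K : ℕ} (hK : c.Below K) : t₀ < K := by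
  by_contra hlt
  have h1 := hK t₀ (by omega)
  have h2 := hK (t₀ + 1) (by omega)
  have h3 := h.start
  have h4 := h.P_start
  have h5 := h.e_start
  omega

theorem a_eq_zero (h : Shift t₀ gE gO aE aO c c') {K : ℕ} (hK : c.Below K) {t : ℕ} (ht : K ≤ t) :
    aE t = 0 ∧ aO t = 0 := by
  have h0 := h.lt_of_below hK
  have h1 := hK t ht
  have h2 := h.O_eq t (by omega)
  have h3 := h.E_eq t
  refine ⟨?_, by omega⟩
  by_cases ht' : t = t₀ + 1
  · subst ht'
    have := h.e_start
    omega
  · have := h3 ht'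
    omega

theorem below_right (h : Shift t₀ gE gO aE aO c c') {K : ℕ} (hK : c.Below K) :
    c'.Below (K + 1) := by
  intro t ht
  have h0 := h.lt_of_below hK
  obtain ⟨t, rfl⟩ : ∃ s, t = s + 1 := ⟨t - 1, by omega⟩
  have h1 := hK (t + 1) (by omega)
  have h2 := h.a_eq_zero hK (t := t) (by omega)
  have h3 := h.a_eq_zero hK (t := t + 1) (by omega)
  have h4 := h.E_succ' t
  have h5 := h.O_succ' t
  have h6 := h.O_eq (t + 1) (by omega)
  have h7 := h.E_eq (t + 1) (by omega)
  have h8 := h.e_high (t + 1) (by omega)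
  have h9 := h.P_high (t + 1) (by omega)
  omega

theorem below_left (h : Shift t₀ gE gO aE aO c c') {K : ℕ} (hK : c'.Below K) : c.Below K := by
  have ha : ∀ t, K ≤ t + 1 → aE t = 0 ∧ aO t = 0 ∧ gE (t + 1) = 0 ∧ gO (t + 1) = 0 := by
    intro t ht
    have h1 := hK (t + 1) ht
    have h2 := h.E_succ' t
    have h3 := h.O_succ' t
    omega
  have h0 := h.start
  have hlt : t₀ + 1 < K := by
    by_contra hlt
    have h1 := ha t₀ (by omega)
    have h2 := ha (t₀ + 1) (by omega)
    omega
  intro t ht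
  obtain ⟨t, rfl⟩ : ∃ s, t = s + 1 := ⟨t - 1, by omega⟩
  have h1 := ha t (by omega)
  have h2 := ha (t + 1) (by omega)
  have h3 := hK (t + 1) (by omega)
  have h6 := h.O_eq (t + 1) (by omega)
  have h7 := h.E_eq (t + 1) (by omega)
  have h8 := h.e_eq (t + 1) (by omega)
  have h9 := h.P_eq (t + 1) (by omega)
  omega

/-- Moving the parts preserves the number of parts kept in every capacity, that is, the number of
parts with marks up to `r`. -/
theorem kept_eq (h : Shift t₀ gE gO aE aO c c') {r : ℕ} (hr : 1 ≤ r) {K : ℕ} (hK : c.Below K) :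
    c'.kept r (K + 1) = c.kept r K := by
  have h0 := h.lt_of_below hK
  obtain ⟨l, l', X, X', hl, hl', hX, hX', H⟩ := h.couple hr (K - t₀)
  rw [show t₀ + 1 + (K - t₀) = K + 1 by omega, show t₀ + (K - t₀) = K by omega] at *
  have h1 := h.a_eq_zero hK (le_refl K)
  have h2 := h.a_eq_zero hK (Nat.le_succ K)
  have h3 := hK (K + 1) (by omega)
  have h4 := h.below_right hK (K + 1) le_rfl
  have h5 : c.keptE r (K + 1) = 0 := by rw [keptE_succ]; omega
  have h6 : c'.keptE r (K + 1) = 0 := by rw [keptE_succ]; omega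
  have h7 := kept_of_below hK r (Nat.le_succ K)
  simp only [Nat.succ_eq_add_one] at *
  omega

end Shift

/-- The number of parts of size up to `2T` that are moved, if `aE` and `aO` are as in `Shift`. -/
def moved (aE aO : ℕ → ℕ) (T : ℕ) : ℕ := ∑ t ∈ Finset.range T, (aO t + aE (t + 1))

theorem moved_succ (aE aO : ℕ → ℕ) (T : ℕ) :
    moved aE aO (T + 1) = moved aE aO T + (aO T + aE (T + 1)) :=
  Finset.sum_range_succ _ _

namespace Shift

variable {t₀ : ℕ} {gE gO aE aO : ℕ → ℕ} {c c' : Conf}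

theorem EO_eq (h : Shift t₀ gE gO aE aO c c') (t : ℕ) :
    c.E t + c.e t = gE t + aE t + c'.e t ∧ c.O t + c.P t = gO t + aO t + c'.P t := by
  constructor
  · by_cases ht : t = t₀ + 1
    · subst ht
      have h1 := h.E_start
      have h2 := h.e_start
      omega
    · have h1 := h.E_eq t ht
      have h2 := h.e_eq t ht
      omega
  · by_cases ht : t = t₀
    · subst ht
      have h1 := h.O_start
      have h2 := h.P_start
      omega
    · have h1 := h.O_eq t ht
      have h2 := h.P_eq t ht
      omega

/-- The sizes of the parts up to `2T + 1`; the parts of size `2T` and `2T + 1` that are moved have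
left this range. -/
theorem weight_aux (h : Shift t₀ gE gO aE aO c c') (T : ℕ) :
    c'.weight (T + 1) + (2 * T + 1) * aO T + (2 * T + 2) * aE T =
      c.weight (T + 1) + 2 * moved aE aO T := by
  induction T with
  | zero =>
    have h1 := h.EO_eq 0
    have h2 := h.aE_low 0 (by omega)
    have h3 := h.O_zero'
    simp only [weight, moved, Finset.sum_range_succ, Finset.sum_range_zero]
    simp only [mul_zero, zero_mul, zero_add, one_mul]
    omega
  | succ T ih =>
    have h1 := h.EO_eq (T + 1)
    have h2 := h.E_succ' T
    have h3 := h.O_succ' T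
    have e1 : ∀ d : Conf, d.weight (T + 1 + 1) = d.weight (T + 1) +
        (2 * (T + 1) * (d.E (T + 1) + d.e (T + 1)) + (2 * (T + 1) + 1) *
          (d.O (T + 1) + d.P (T + 1))) := fun d => Finset.sum_range_succ _ _
    rw [e1, e1, moved_succ, h1.1, h1.2, h2, h3]
    linarith

/-- The numbers of the parts up to `2T + 1`; the parts of size `2T` and `2T + 1` that are moved have
left this range. -/
theorem card_aux (h : Shift t₀ gE gO aE aO c c') (T : ℕ) :
    c'.card (T + 1) + aO T + aE T = c.card (T + 1) := by
  induction T with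
  | zero =>
    have h1 := h.EO_eq 0
    have h3 := h.O_zero'
    have h4 := h.E_zero'
    simp only [card, Finset.sum_range_succ, Finset.sum_range_zero]
    omega
  | succ T ih =>
    have h1 := h.EO_eq (T + 1)
    have h2 := h.E_succ' T
    have h3 := h.O_succ' T
    have e1 : ∀ d : Conf, d.card (T + 1 + 1) = d.card (T + 1) +
        (d.E (T + 1) + d.e (T + 1) + d.O (T + 1) + d.P (T + 1)) :=
      fun d => Finset.sum_range_succ _ _
    rw [e1, e1]
    omega

theorem weight_eq (h : Shift t₀ gE gO aE aO c c') {K : ℕ} (hK : c.Below K) :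
    c'.weight (K + 1) = c.weight K + 2 * moved aE aO K := by
  have h1 := h.weight_aux K
  have h2 := h.a_eq_zero hK le_rfl
  rw [h2.1, h2.2, weight_of_below hK (Nat.le_succ K)] at h1
  simpa using h1

theorem card_eq (h : Shift t₀ gE gO aE aO c c') {K : ℕ} (hK : c.Below K) :
    c'.card (K + 1) = c.card K := by
  have h1 := h.card_aux K
  have h2 := h.a_eq_zero hK le_rfl
  rw [h2.1, h2.2, card_of_below hK (Nat.le_succ K)] at h1
  simpa using h1

/-- Beyond `2t₀ + 1`, the moved parts are those with mark `1`, i.e. those kept by the scan of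
capacity `1`. -/
theorem a_eq_kept (h : Shift t₀ gE gO aE aO c c') {t : ℕ} (ht : t₀ < t) :
    aE t = c.e t + c.keptE 1 t ∧ aO t = c.keptO 1 t := by
  have hO : ∀ t, t₀ < t → aE t = c.e t + c.keptE 1 t → aO t = c.keptO 1 t := by
    intro t ht h0
    have h1 := h.O_eq t (by omega)
    have h2 := h.odd t ht
    have h3 := h.excl t (by omega)
    rw [keptO]
    omega
  suffices hE : aE t = c.e t + c.keptE 1 t from ⟨hE, hO t ht hE⟩
  induction t, ht using Nat.le_induction with
  | base =>
    have h1 := h.start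
    have h2 := h.P_start
    have h3 := h.e_start
    have h4 := h.e_high (t₀ + 1) (by omega)
    simp only [Nat.succ_eq_add_one]
    rw [keptE_succ]
    omega
  | succ t ht ih =>
    have h1 := hO t ht ih
    have h2 := h.E_eq (t + 1) (by omega)
    have h3 := h.excl t (by omega)
    have h4 := h.full t (by omega)
    have h5 := h.e_high (t + 1) (by omega)
    have h6 := h.e_eq (t + 1) (by omega)
    have h7 := h.P_high t (by omega)
    have h8 := h.P_eq t (by omega)
    rw [keptE_succ]
    omega

/-- The moved parts are the last ones among those with mark `1`. -/
theorem kept_one (h : Shift t₀ gE gO aE aO c c') {T : ℕ} (hT : t₀ < T) :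
    c.kept 1 T + aE T = c'.kept 1 (t₀ + 1) + moved aE aO T := by
  induction T, hT using Nat.le_induction with
  | base =>
    have h1 := h.kept_start 1
    have h2 : moved aE aO t₀ = 0 := by
      refine Finset.sum_eq_zero fun t ht => ?_
      have := Finset.mem_range.1 ht
      rw [h.aO_low t this, h.aE_low (t + 1) this]; rfl
    simp only [Nat.succ_eq_add_one]
    rw [moved_succ]
    omega
  | succ T hT ih =>
    have h1 := h.a_eq_kept (t := T) hT
    have h2 := h.P_eq T (by omega)
    have h3 := h.P_high T (by omega)
    rw [moved_succ, kept_succ]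
    omega

/-- The last bad part determines which parts are moved. -/
theorem right_unique {t₁ : ℕ} {gE₁ gO₁ aE₁ aO₁ : ℕ → ℕ} {c₁ : Conf}
    (h : Shift t₀ gE gO aE aO c c') (h' : Shift t₁ gE₁ gO₁ aE₁ aO₁ c c₁) : c' = c₁ := by
  have key : ∀ {t₀ t₁ : ℕ} {gE gO aE aO gE₁ gO₁ aE₁ aO₁ : ℕ → ℕ} {c c' c₁ : Conf},
      Shift t₀ gE gO aE aO c c' → Shift t₁ gE₁ gO₁ aE₁ aO₁ c c₁ → t₁ ≤ t₀ := by
    intro t₀ t₁ gE gO aE aO gE₁ gO₁ aE₁ aO₁ c c' c₁ h h'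
    by_contra hlt
    have h1 := h'.start
    have h2 := h'.P_start
    have h3 := h'.e_start
    have h4 := h.e_eq (t₁ + 1) (by omega)
    have h5 := h.P_eq t₁ (by omega)
    have h6 := h.e_high (t₁ + 1) (by omega)
    have h7 := h.P_high t₁ (by omega)
    omega
  obtain rfl : t₀ = t₁ := le_antisymm (key h' h) (key h h')
  have hE : aE = aE₁ := by
    funext t
    rcases Nat.lt_or_ge t₀ t with ht | ht
    · rw [(h.a_eq_kept ht).1, (h'.a_eq_kept ht).1]
    · rw [h.aE_low t ht, h'.aE_low t ht]
  subst hE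
  have hO : aO = aO₁ := by
    funext t
    rcases Nat.lt_trichotomy t t₀ with ht | rfl | ht
    · rw [h.aO_low t ht, h'.aO_low t ht]
    · have h1 := h.start
      have h2 := h'.start
      omega
    · rw [(h.a_eq_kept ht).2, (h'.a_eq_kept ht).2]
  subst hO
  have hgE : gE = gE₁ := by
    funext t
    by_cases ht : t = t₀ + 1
    · subst ht
      rw [← h.E_start, ← h'.E_start]
    · have h1 := h.E_eq t ht
      have h2 := h'.E_eq t ht
      omega
  subst hgE
  have hgO : gO = gO₁ := by
    funext t
    by_cases ht : t = t₀
    · subst ht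
      rw [← h.O_start, ← h'.O_start]
    · have h1 := h.O_eq t ht
      have h2 := h'.O_eq t ht
      omega
  subst hgO
  ext t
  · rcases t with _ | t
    · rw [h.E_zero', h'.E_zero']
    · rw [h.E_succ', h'.E_succ']
  · by_cases ht : t = t₀ + 1
    · subst ht
      rw [h.e_high _ (Nat.lt_succ_self _), h'.e_high _ (Nat.lt_succ_self _)]
    · rw [← h.e_eq t ht, ← h'.e_eq t ht]
  · rcases t with _ | t
    · rw [h.O_zero', h'.O_zero']
    · rw [h.O_succ', h'.O_succ']
  · by_cases ht : t = t₀
    · subst ht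
      have h1 := h.P_start
      have h2 := h'.P_start
      omega
    · rw [← h.P_eq t ht, ← h'.P_eq t ht]

theorem moved_eq_Ico (h : Shift t₀ gE gO aE aO c c') (K : ℕ) :
    moved aE aO K = ∑ t ∈ Finset.Ico t₀ K, (aO t + aE (t + 1)) := by
  rw [moved, Finset.range_eq_Ico]
  refine (Finset.sum_subset (Finset.Ico_subset_Ico_left (Nat.zero_le _)) fun t ht ht' => ?_).symm
  rw [Finset.mem_Ico] at ht ht'
  rw [h.aO_low t (by omega), h.aE_low (t + 1) (by omega)]; rfl

/-- The images of the moved parts are the largest ones selected by the greedy scan from above, so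
their number determines them. -/
theorem left_unique {t₁ K : ℕ} {gE₁ gO₁ aE₁ aO₁ : ℕ → ℕ} {c₁ : Conf}
    (h : Shift t₀ gE gO aE aO c c') (h' : Shift t₁ gE₁ gO₁ aE₁ aO₁ c₁ c') (hK : c'.Below K)
    (hp : moved aE aO K = moved aE₁ aO₁ K) : c = c₁ := by
  have agree : ∀ {t₀ t₁ : ℕ} {gE gO aE aO gE₁ gO₁ aE₁ aO₁ : ℕ → ℕ} {c c₁ : Conf},
      Shift t₀ gE gO aE aO c c' → Shift t₁ gE₁ gO₁ aE₁ aO₁ c₁ c' → t₀ ≤ t₁ →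
        ∀ t, t₁ ≤ t → aO t = aO₁ t ∧ aE (t + 1) = aE₁ (t + 1) := by
    intro t₀ t₁ gE gO aE aO gE₁ gO₁ aE₁ aO₁ c c₁ h h' hle
    have large : ∀ t, K ≤ t → aO t = aO₁ t ∧ aE (t + 1) = aE₁ (t + 1) := by
      intro t ht
      have h1 := h.a_eq_zero (h.below_left hK) ht
      have h2 := h'.a_eq_zero (h'.below_left hK) ht
      have h3 := h.a_eq_zero (h.below_left hK) (t := t + 1) (by omega)
      have h4 := h'.a_eq_zero (h'.below_left hK) (t := t + 1) (by omega)
      omega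
    have down : ∀ n t, t₁ ≤ t → K ≤ t + n → aO t = aO₁ t ∧ aE (t + 1) = aE₁ (t + 1) := by
      intro n
      induction n with
      | zero => exact fun t _ ht => large t ht
      | succ n ih =>
        intro t ht htn
        obtain ⟨i1, i2⟩ := ih (t + 1) (by omega) (by omega)
        have h1 := h.E_succ' (t + 1)
        have h2 := h.excl (t + 1) (by omega)
        have h3 := h.full (t + 1) (by omega)
        have h4 := h'.E_succ' (t + 1)
        have h5 := h'.excl (t + 1) (by omega)
        have h6 := h'.full (t + 1) (by omega)
        have j : aE (t + 1) = aE₁ (t + 1) := by omega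
        have h7 := h.O_succ' t
        have h8 := h.excl t (by omega)
        have h9 := h.odd (t + 1) (by omega)
        have h10 := h'.O_succ' t
        have h11 := h'.excl t (by omega)
        have h12 := h'.odd (t + 1) (by omega)
        omega
    exact fun t ht => down K t ht (by omega)
  have key : ∀ {t₀ t₁ : ℕ} {gE gO aE aO gE₁ gO₁ aE₁ aO₁ : ℕ → ℕ} {c c₁ : Conf},
      Shift t₀ gE gO aE aO c c' → Shift t₁ gE₁ gO₁ aE₁ aO₁ c₁ c' →
        moved aE aO K = moved aE₁ aO₁ K → t₁ ≤ t₀ := by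
    intro t₀ t₁ gE gO aE aO gE₁ gO₁ aE₁ aO₁ c c₁ h h' hp
    by_contra hlt
    have h0 := h'.lt_of_below (h'.below_left hK)
    rw [h.moved_eq_Ico, h'.moved_eq_Ico,
      ← Finset.sum_Ico_consecutive _ (show t₀ ≤ t₁ by omega) h0.le,
      Finset.sum_congr rfl (fun t ht => by
        have := agree h h' (by omega) t (Finset.mem_Ico.1 ht).1
        rw [this.1, this.2] : ∀ t ∈ Finset.Ico t₁ K, aO t + aE (t + 1) = aO₁ t + aE₁ (t + 1)),
      Finset.sum_eq_sum_Ico_succ_bot (by omega), h.start] at hp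
    omega
  obtain rfl : t₀ = t₁ := le_antisymm (key h' h hp.symm) (key h h' hp)
  have hE : aE = aE₁ := by
    funext t
    rcases Nat.lt_or_ge t₀ t with ht | ht
    · obtain ⟨t, rfl⟩ : ∃ s, t = s + 1 := ⟨t - 1, by omega⟩
      exact (agree h h' le_rfl t (by omega)).2
    · rw [h.aE_low t ht, h'.aE_low t ht]
  subst hE
  have hO : aO = aO₁ := by
    funext t
    rcases Nat.lt_or_ge t t₀ with ht | ht
    · rw [h.aO_low t ht, h'.aO_low t ht]
    · exact (agree h h' le_rfl t ht).1
  subst hO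
  have hgE : gE = gE₁ := by
    funext t
    rcases t with _ | t
    · rw [← h.E_zero', ← h'.E_zero']
    · have h1 := h.E_succ' t
      have h2 := h'.E_succ' t
      omega
  subst hgE
  have hgO : gO = gO₁ := by
    funext t
    rcases t with _ | t
    · rw [← h.O_zero', ← h'.O_zero']
    · have h1 := h.O_succ' t
      have h2 := h'.O_succ' t
      omega
  subst hgO
  ext t
  · by_cases ht : t = t₀ + 1
    · subst ht
      rw [h.E_start, h'.E_start]
    · rw [h.E_eq t ht, h'.E_eq t ht]
  · by_cases ht : t = t₀ + 1
    · subst ht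
      rw [h.e_start, h'.e_start]
    · rw [h.e_eq t ht, h'.e_eq t ht]
  · by_cases ht : t = t₀
    · subst ht
      rw [h.O_start, h'.O_start]
    · rw [h.O_eq t ht, h'.O_eq t ht]
  · by_cases ht : t = t₀
    · subst ht
      rw [h.P_start, h'.P_start]
    · rw [h.P_eq t ht, h'.P_eq t ht]

end Shift
end Conf

/-! ### Existence of the moves -/

namespace Conf

/-- The frequencies of a member of `setF k i N`. -/
structure InF (k i : ℕ) (N : ℕ → ℕ) (c : Conf) : Prop extends c.Proper where
  first : c.O 0 + c.E 1 + 1 ≤ i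
  cap : ∀ t, c.e t + c.E t + c.O t + c.E (t + 1) + 1 ≤ k
  cap_of_P : ∀ t, 1 ≤ c.P t → c.E (t + 1) + 2 ≤ k
  small_P : ∀ t, 0 < c.P t → ∃ s, s ≤ t ∧ 0 < c.O s + c.E s
  small_e : ∀ t, 0 < c.e t → ∃ s, s < t ∧ 0 < c.O s + c.E s
  kept_eq : ∀ K, c.Below K → ∀ r, 1 ≤ r → r < k → c.kept r K = ∑ s ∈ Finset.Icc 1 r, N s

/-- All bad parts are among the first `m` parts with mark `1`. -/
def BadLE (m : ℕ) (c : Conf) : Prop :=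
  (∀ t, 0 < c.P t → c.kept 1 (t + 1) ≤ m) ∧ (∀ t, 0 < c.e t → c.kept 1 t + 1 ≤ m)

theorem kept_eq_of_below {c : Conf} {K L : ℕ} (hK : c.Below K) (hL : c.Below L) (r : ℕ) :
    c.kept r K = c.kept r L := by
  rw [← kept_of_below hK r (le_max_left K L), ← kept_of_below hL r (le_max_right K L)]

theorem keptE_le (c : Conf) (r t : ℕ) : c.keptE r t ≤ c.E t := by
  rcases t with _ | t
  · exact Nat.zero_le _
  · rw [keptE_succ]; omega

theorem keptO_le (c : Conf) (r t : ℕ) : c.keptO r t ≤ c.O t := min_le_left _ _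

/-- The conditions of `setO (r + 1)` hold exactly when the greedy scan of capacity `r` keeps all
parts. -/
theorem cap_iff_kept {c : Conf} (hc : c.Proper) {k K : ℕ} (hk : 2 ≤ k) (hK : c.Below K) :
    ((∀ t, c.e t + c.E t + c.O t + c.E (t + 1) + 1 ≤ k) ∧
      ∀ t, 1 ≤ c.P t → c.E (t + 1) + 2 ≤ k) ↔ c.kept (k - 1) K = c.card K := by
  obtain ⟨r, rfl⟩ : ∃ r, k = r + 1 := ⟨k - 1, by omega⟩
  rw [Nat.add_sub_cancel]
  have hle : ∀ t ∈ Finset.range K, c.e t + c.P t + c.keptE r t + c.keptO r t ≤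
      c.E t + c.e t + c.O t + c.P t := fun t _ => by
    have h1 := c.keptE_le r t
    have h2 := c.keptO_le r t
    omega
  rw [kept, card, Finset.sum_eq_sum_iff_of_le hle]
  constructor
  · rintro ⟨h1, h2⟩ t -
    have hE : c.keptE r t = c.E t := by
      induction t with
      | zero => rw [keptE_zero, hc.E_zero]
      | succ t ih =>
        have h3 := h1 t
        have h4 := h1 (t + 1)
        have h5 := h2 t
        have h6 := c.keptO_le r t
        rw [keptE_succ]
        omega
    have hO : c.keptO r t = c.O t := by
      have h3 := h1 t
      rw [keptO, hE]
      omega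
    omega
  · intro H
    have hE : ∀ t, c.keptE r t = c.E t := by
      intro t
      rcases Nat.lt_or_ge t K with ht | ht
      · have h1 := H t (Finset.mem_range.2 ht)
        have h2 := c.keptE_le r t
        have h3 := c.keptO_le r t
        omega
      · have h1 := hK t ht
        have h2 := c.keptE_le r t
        omega
    have hO : ∀ t, c.keptO r t = c.O t := by
      intro t
      rcases Nat.lt_or_ge t K with ht | ht
      · have h1 := H t (Finset.mem_range.2 ht)
        have h2 := c.keptE_le r t
        have h3 := c.keptO_le r t
        omega
      · have h1 := hK t ht
        have h2 := c.keptO_le r t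
        omega
    have hload : ∀ t, c.e t + c.E t ≤ r := by
      intro t
      rcases t with _ | t
      · rw [hc.E_zero, hc.e_zero]; omega
      · have h1 := hE (t + 1)
        have h2 := hc.e_le (t + 1)
        rw [keptE_succ] at h1
        omega
    have hnext : ∀ t, c.E (t + 1) ≤ r - max (c.e t + c.E t + c.O t) (min 1 (c.P t)) := by
      intro t
      have h1 := hE (t + 1)
      rw [keptE_succ, hE t, hO t] at h1
      omega
    have hodd : ∀ t, c.O t ≤ r - (c.e t + c.E t) := by
      intro t
      have h1 := hO t
      rw [keptO, hE] at h1
      omega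
    refine ⟨fun t => ?_, fun t ht => ?_⟩
    · have h1 := hnext t
      have h2 := hodd t
      have h3 := hload t
      omega
    · have h1 := hnext t
      omega

/-- The parts can be moved if there is a bad part. -/
theorem exists_shift {c : Conf} (hc : c.Proper) {t₀ : ℕ}
    (hbad : 0 < c.P t₀ ∧ c.e (t₀ + 1) = 0 ∨ 0 < c.e (t₀ + 1))
    (he : ∀ t, t₀ + 1 < t → c.e t = 0) (hP : ∀ t, t₀ < t → c.P t = 0) :
    ∃ gE gO aE aO c', Shift t₀ gE gO aE aO c c' := by
  obtain ⟨aE, haE⟩ : ∃ aE : ℕ → ℕ, aE = fun t => if t ≤ t₀ then 0 else c.e t + c.keptE 1 t :=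
    ⟨_, rfl⟩
  obtain ⟨aO, haO⟩ : ∃ aO : ℕ → ℕ, aO = fun t =>
    if t < t₀ then 0 else if t = t₀ then 1 - c.e (t₀ + 1) else c.keptO 1 t := ⟨_, rfl⟩
  have aE_low : ∀ t, t ≤ t₀ → aE t = 0 := fun t ht => by rw [haE]; exact if_pos ht
  have aE_high : ∀ t, t₀ < t → aE t = c.e t + c.keptE 1 t := fun t ht => by
    rw [haE]; exact if_neg (by omega)
  have aO_low : ∀ t, t < t₀ → aO t = 0 := fun t ht => by rw [haO]; exact if_pos ht
  have aO_mid : aO t₀ = 1 - c.e (t₀ + 1) := by rw [haO]; simp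
  have aO_high : ∀ t, t₀ < t → aO t = c.keptO 1 t := fun t ht => by
    rw [haO]
    simp only
    rw [if_neg (by omega), if_neg (by omega)]
  have hstart : aE (t₀ + 1) = c.e (t₀ + 1) := by
    have h1 := hc.e_le (t₀ + 1)
    rw [aE_high (t₀ + 1) (by omega), keptE_succ]
    omega
  have aE_le : ∀ t, t ≠ t₀ + 1 → aE t ≤ c.E t := by
    intro t ht
    rcases Nat.lt_or_ge t₀ t with h | h
    · rw [aE_high t h, he t (by omega)]
      have := c.keptE_le 1 t
      omega
    · rw [aE_low t h]; exact Nat.zero_le _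
  have aO_le : ∀ t, t ≠ t₀ → aO t ≤ c.O t := by
    intro t ht
    rcases Nat.lt_or_ge t t₀ with h | h
    · rw [aO_low t h]; exact Nat.zero_le _
    · rw [aO_high t (by omega)]
      exact c.keptO_le 1 t
  have hrule : ∀ t, t₀ < t → aE (t + 1) = min (c.E (t + 1)) (1 - (aE t + aO t)) := by
    intro t ht
    rw [aE_high _ (by omega), keptE_succ, he _ (by omega), hP t ht, aE_high t ht, aO_high t ht]
    omega
  have hruleO : ∀ t, t₀ < t → aO t = min (c.O t) (1 - aE t) := by
    intro t ht
    rw [aO_high t ht, aE_high t ht, keptO]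
  have hone : ∀ t, aE t ≤ 1 := by
    intro t
    rcases Nat.lt_trichotomy t (t₀ + 1) with h | h | h
    · rw [aE_low t (by omega)]; omega
    · rw [h, hstart]; exact hc.e_le _
    · obtain ⟨t, rfl⟩ : ∃ s, t = s + 1 := ⟨t - 1, by omega⟩
      rw [hrule t (by omega)]; omega
  refine ⟨fun t => if t = t₀ + 1 then c.E t else c.E t - aE t,
    fun t => if t = t₀ then c.O t else c.O t - aO t, aE, aO,
    { E := fun t => (if t = t₀ + 1 then c.E t else c.E t - aE t) + if t = 0 then 0 else aE (t - 1)
      e := fun t => if t₀ < t then 0 else c.e t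
      O := fun t => (if t = t₀ then c.O t else c.O t - aO t) + if t = 0 then 0 else aO (t - 1)
      P := fun t => if t = t₀ then c.P t - aO t else c.P t },
    { aE_low := aE_low
      aO_low := aO_low
      start := by
        have := hc.e_le (t₀ + 1)
        omega
      excl := ?_
      full := ?_
      odd := ?_
      E_eq := ?_
      E_start := by simp
      O_eq := ?_
      O_start := by simp
      e_eq := ?_
      e_start := by simp [hstart]
      P_eq := ?_
      P_start := ?_
      E_zero' := by simp
      E_succ' := by simp
      O_zero' := by simp
      O_succ' := by simp
      e_high := ?_
      P_high := ?_ }⟩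
  · intro t ht
    rcases Nat.eq_or_lt_of_le ht with rfl | ht
    · have h1 := aE_low t₀ le_rfl
      have h2 := hc.e_le (t₀ + 1)
      omega
    · have h1 := hrule t ht
      have h2 := hruleO t ht
      have h3 := hone t
      omega
  · intro t ht hpos
    rcases Nat.eq_or_lt_of_le ht with rfl | ht
    · have h1 := aE_low t₀ le_rfl
      have h2 := hc.e_le (t₀ + 1)
      omega
    · rw [if_neg (by omega)] at hpos
      have h1 := hrule t ht
      have h2 := hruleO t ht
      have h3 := hone t
      omega
  · intro t ht
    rw [if_neg (by omega)]
    have h1 := hruleO t ht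
    have h2 := hc.O_le t
    have h3 := hone t
    omega
  · intro t ht
    rw [if_neg ht]
    have := aE_le t ht
    omega
  · intro t ht
    rw [if_neg ht]
    have := aO_le t ht
    omega
  · intro t ht
    simp only
    split_ifs with h
    · exact he t (by omega)
    · rfl
  · intro t ht
    simp only
    rw [if_neg ht]
  · simp only [if_true]
    have := hc.e_le (t₀ + 1)
    omega
  · intro t ht
    simp only
    rw [if_pos ht]
  · intro t ht
    simp only
    rw [if_neg (by omega)]
    exact hP t ht

/-- The greedy selection of the good parts from above: `bE` and `bO` select a part `2t` or `2t + 1`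
if it does not conflict with the larger parts selected already. -/
theorem exists_scan_above (c : Conf) {K : ℕ} (hK : c.Below K) : ∃ bE bO : ℕ → ℕ,
    (∀ t, bO t = if 0 < c.O t ∧ bE (t + 1) = 0 then 1 else 0) ∧
      ∀ t, bE t = if 0 < c.E t ∧ bO t = 0 ∧ bE (t + 1) = 0 then 1 else 0 := by
  obtain ⟨f, hf0, hf⟩ : ∃ f : ℕ → ℕ, f 0 = 0 ∧ ∀ n, f (n + 1) =
      if 0 < c.E (K - (n + 1)) ∧ (if 0 < c.O (K - (n + 1)) ∧ f n = 0 then 1 else 0) = 0 ∧ f n = 0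
      then 1 else 0 :=
    ⟨fun n => Nat.rec 0 (fun n x => if 0 < c.E (K - (n + 1)) ∧
      (if 0 < c.O (K - (n + 1)) ∧ x = 0 then 1 else 0) = 0 ∧ x = 0 then 1 else 0) n,
      rfl, fun n => rfl⟩
  refine ⟨fun t => f (K - t),
    fun t => if 0 < c.O t ∧ f (K - (t + 1)) = 0 then 1 else 0, fun t => rfl, fun t => ?_⟩
  rcases Nat.lt_or_ge t K with ht | ht
  · obtain ⟨n, hn⟩ : ∃ n, K - t = n + 1 := ⟨K - t - 1, by omega⟩
    have h1 : K - (n + 1) = t := by omega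
    have h2 : K - (t + 1) = n := by omega
    simp only [h2]
    rw [hn, hf, h1]
  · have h1 : K - t = 0 := by omega
    simp only [h1]
    rw [hf0, (hK t ht).1, if_neg (by omega)]

/-- The greedy selection from above finds at least as many parts as the scan from below. -/
theorem sum_kept_le_sum_scan {c : Conf} {K : ℕ} (hK : c.Below K) {bE bO : ℕ → ℕ}
    (hO : ∀ t, bO t = if 0 < c.O t ∧ bE (t + 1) = 0 then 1 else 0)
    (hE : ∀ t, bE t = if 0 < c.E t ∧ bO t = 0 ∧ bE (t + 1) = 0 then 1 else 0) (t : ℕ) :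
    ∑ s ∈ Finset.Ico t K, (c.keptO 1 (s + 1) + c.keptE 1 (s + 2)) ≤
      ∑ s ∈ Finset.Ico t K, (bO (s + 1) + bE (s + 2)) := by
  suffices H : ∀ n t, K ≤ t + n →
      ∃ x y, x = ∑ s ∈ Finset.Ico t K, (c.keptO 1 (s + 1) + c.keptE 1 (s + 2)) ∧
        y = ∑ s ∈ Finset.Ico t K, (bO (s + 1) + bE (s + 2)) ∧ x ≤ y ∧
        (x = y → bO (t + 1) + bE (t + 2) ≤ c.keptO 1 (t + 1) + c.keptE 1 (t + 2)) by
    obtain ⟨x, y, hx, hy, h, -⟩ := H K t (by omega)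
    omega
  have high : ∀ t, K ≤ t → bO (t + 1) + bE (t + 2) = 0 := by
    intro t ht
    have h1 := hO (t + 1)
    have h2 := hE (t + 2)
    rw [(hK (t + 1) (by omega)).2.2.1, if_neg (by omega)] at h1
    rw [(hK (t + 2) (by omega)).1, if_neg (by omega)] at h2
    omega
  intro n
  induction n with
  | zero =>
    intro t ht
    refine ⟨0, 0, ?_, ?_, le_rfl, fun _ => ?_⟩
    · rw [Finset.Ico_eq_empty (by omega), Finset.sum_empty]
    · rw [Finset.Ico_eq_empty (by omega), Finset.sum_empty]
    · rw [high t (by omega)]; exact Nat.zero_le _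
  | succ n ih =>
    intro t ht
    rcases Nat.lt_or_ge t K with htK | htK
    · obtain ⟨x, y, hx, hy, hle, heq⟩ := ih (t + 1) (by omega)
      refine ⟨_, _, rfl, rfl, ?_⟩
      rw [Finset.sum_eq_sum_Ico_succ_bot htK, Finset.sum_eq_sum_Ico_succ_bot htK, ← hx, ← hy]
      have h1 := hO (t + 1)
      have h2 := hE (t + 2)
      have h3 := hO (t + 2)
      have h4 := hE (t + 3)
      have k1 := c.keptE_le 1 (t + 2)
      have k2 := c.keptO_le 1 (t + 1)
      have k3 : c.keptO 1 (t + 1) + c.keptE 1 (t + 2) ≤ 1 := by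
        rw [keptE_succ, keptO]; omega
      have k4 : c.keptE 1 (t + 2) + c.keptO 1 (t + 2) + c.keptE 1 (t + 3) ≤ 1 := by
        rw [keptE_succ c 1 (t + 2), keptO]; omega
      simp only [show t + 1 + 1 = t + 2 by omega, show t + 1 + 2 = t + 3 by omega] at *
      clear hx hy hO hE ih high
      split_ifs at h1 h2 h3 h4 <;> omega
    · refine ⟨0, 0, ?_, ?_, le_rfl, fun _ => ?_⟩
      · rw [Finset.Ico_eq_empty (by omega), Finset.sum_empty]
      · rw [Finset.Ico_eq_empty (by omega), Finset.sum_empty]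
      · rw [high t (by omega)]; exact Nat.zero_le _

/-- A tail of a sequence of zeros and ones can be cut off such that it has a given sum and starts
with a one. -/
theorem exists_tail_sum {u : ℕ → ℕ} (hu : ∀ t, u t ≤ 1) {z K p : ℕ} (hp : 1 ≤ p)
    (h : p ≤ ∑ s ∈ Finset.Ico z K, u s) :
    ∃ t, z ≤ t ∧ t < K ∧ u t = 1 ∧ ∑ s ∈ Finset.Ico t K, u s = p := by
  obtain ⟨n, hn⟩ : ∃ n, K = z + n := by
    refine ⟨K - z, ?_⟩
    by_contra hlt
    rw [Finset.Ico_eq_empty (by omega), Finset.sum_empty] at h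
    omega
  induction n generalizing z with
  | zero =>
    rw [Finset.Ico_eq_empty (by omega), Finset.sum_empty] at h
    omega
  | succ n ih =>
    have h1 := Finset.sum_eq_sum_Ico_succ_bot (show z < K by omega) u
    have h2 := hu z
    by_cases h3 : p ≤ ∑ s ∈ Finset.Ico (z + 1) K, u s
    · obtain ⟨t, k1, k2, k3, k4⟩ := ih h3 (by omega)
      exact ⟨t, by omega, k2, k3, k4⟩
    · exact ⟨z, le_rfl, by omega, by omega, by omega⟩

/-- Moving parts down: the parts selected from above are moved down to the first one for which a
given number `p` of parts has been moved. -/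
theorem exists_shift_of_scan {c' : Conf} (hc : c'.Proper) {bE bO : ℕ → ℕ}
    (hO : ∀ t, bO t = if 0 < c'.O t ∧ bE (t + 1) = 0 then 1 else 0)
    (hE : ∀ t, bE t = if 0 < c'.E t ∧ bO t = 0 ∧ bE (t + 1) = 0 then 1 else 0) {t₀ : ℕ}
    (hstart : bO (t₀ + 1) + bE (t₀ + 2) = 1) (he : ∀ t, t₀ < t → c'.e t = 0)
    (hP : ∀ t, t₀ < t → c'.P t = 0) :
    ∃ gE gO aE aO c, Shift t₀ gE gO aE aO c c' ∧
      ∀ t, t₀ ≤ t → aO t + aE (t + 1) = bO (t + 1) + bE (t + 2) := by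
  obtain ⟨aE, haE⟩ : ∃ aE : ℕ → ℕ, aE = fun t => if t ≤ t₀ then 0 else bE (t + 1) := ⟨_, rfl⟩
  obtain ⟨aO, haO⟩ : ∃ aO : ℕ → ℕ, aO = fun t => if t < t₀ then 0 else bO (t + 1) := ⟨_, rfl⟩
  have aE_low : ∀ t, t ≤ t₀ → aE t = 0 := fun t ht => by rw [haE]; exact if_pos ht
  have aE_high : ∀ t, t₀ < t → aE t = bE (t + 1) := fun t ht => by
    rw [haE]; exact if_neg (by omega)
  have aO_low : ∀ t, t < t₀ → aO t = 0 := fun t ht => by rw [haO]; exact if_pos ht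
  have aO_high : ∀ t, t₀ ≤ t → aO t = bO (t + 1) := fun t ht => by
    rw [haO]; exact if_neg (by omega)
  have aE_le : ∀ t, aE t ≤ c'.E (t + 1) := by
    intro t
    rcases Nat.lt_or_ge t₀ t with h | h
    · have h1 := hE (t + 1)
      rw [aE_high t h]
      split_ifs at h1 <;> omega
    · rw [aE_low t h]; exact Nat.zero_le _
  have aO_le : ∀ t, aO t ≤ c'.O (t + 1) := by
    intro t
    rcases Nat.lt_or_ge t t₀ with h | h
    · rw [aO_low t h]; exact Nat.zero_le _
    · have h1 := hO (t + 1)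
      rw [aO_high t h]
      split_ifs at h1 <;> omega
  -- the first part selected excludes that the part just below it is selected
  have hbE : bE (t₀ + 1) = 0 := by
    have h1 := hE (t₀ + 1)
    have h2 : t₀ + 1 + 1 = t₀ + 2 := rfl
    rw [h2] at h1
    split_ifs at h1 <;> omega
  have aE_high' : ∀ t, t₀ ≤ t → aE t = bE (t + 1) := by
    intro t ht
    rcases Nat.eq_or_lt_of_le ht with rfl | ht
    · rw [aE_low _ le_rfl, hbE]
    · exact aE_high t ht
  refine ⟨fun t => if t = 0 then c'.E 0 else c'.E t - aE (t - 1),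
    fun t => if t = 0 then c'.O 0 else c'.O t - aO (t - 1), aE, aO,
    { E := fun t => (if t = 0 then c'.E 0 else c'.E t - aE (t - 1)) +
        if t = t₀ + 1 then 0 else aE t
      e := fun t => c'.e t + if t = t₀ + 1 then aE t else 0
      O := fun t => (if t = 0 then c'.O 0 else c'.O t - aO (t - 1)) + if t = t₀ then 0 else aO t
      P := fun t => c'.P t + if t = t₀ then aO t else 0 },
    { aE_low := aE_low
      aO_low := aO_low
      start := by
        rw [aO_high _ le_rfl, aE_high' _ (by omega)]
        exact hstart
      excl := ?_
      full := ?_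
      odd := ?_
      E_eq := ?_
      E_start := by simp
      O_eq := ?_
      O_start := by simp
      e_eq := ?_
      e_start := by simp
      P_eq := ?_
      P_start := by simp
      E_zero' := by simp
      E_succ' := ?_
      O_zero' := by simp
      O_succ' := ?_
      e_high := he
      P_high := hP }, ?_⟩
  · intro t ht
    have h1 := hE (t + 1)
    have h2 := hO (t + 1)
    have h3 := hE (t + 2)
    rw [aE_high' t ht, aO_high t ht, aE_high' (t + 1) (by omega)]
    simp only [show t + 1 + 1 = t + 2 by omega] at *
    split_ifs at h1 h2 h3 <;> omega
  · intro t ht hpos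
    have h1 := hE (t + 1)
    have h2 := hO (t + 1)
    have h3 := hE (t + 2)
    rw [if_neg (by omega), Nat.add_sub_cancel, aE_high' t ht] at hpos
    rw [aE_high' t ht, aO_high t ht, aE_high' (t + 1) (by omega)]
    simp only [show t + 1 + 1 = t + 2 by omega] at *
    split_ifs at h1 h2 h3 <;> omega
  · intro t ht
    obtain ⟨t, rfl⟩ : ∃ s, t = s + 1 := ⟨t - 1, by omega⟩
    have h1 := hO (t + 1)
    have h2 := hc.O_le (t + 1)
    rw [if_neg (by omega), Nat.add_sub_cancel, aO_high t (by omega),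
      aE_high' (t + 1) (by omega)]
    simp only [show t + 1 + 1 = t + 2 by omega] at *
    split_ifs at h1 <;> omega
  · intro t ht
    simp only
    rw [if_neg ht]
  · intro t ht
    simp only
    rw [if_neg ht]
  · intro t ht
    simp only
    rw [if_neg ht, add_zero]
  · intro t ht
    simp only
    rw [if_neg ht, add_zero]
  · intro t
    have h1 := aE_le t
    rw [if_neg (by omega), Nat.add_sub_cancel]
    omega
  · intro t
    have h1 := aO_le t
    rw [if_neg (by omega), Nat.add_sub_cancel]
    omega
  · intro t ht
    rw [aO_high t ht, aE_high' (t + 1) (by omega)]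

end Conf

/-! ### The moves on the set `setF` -/

namespace Conf

variable {k i m : ℕ} {N : ℕ → ℕ} {c c' : Conf}

namespace Shift

variable {t₀ : ℕ} {gE gO aE aO : ℕ → ℕ}

theorem proper_right (h : Shift t₀ gE gO aE aO c c') (hc : c.Proper) : c'.Proper where
  E_zero := by rw [h.E_low (by omega), hc.E_zero]
  e_zero := by rw [← h.e_eq 0 (by omega), hc.e_zero]
  e_le t := by
    by_cases ht : t = t₀ + 1
    · rw [h.e_high t (by omega)]; omega
    · rw [← h.e_eq t ht]; exact hc.e_le t
  O_le t := by
    rcases Nat.lt_or_ge t₀ t with ht | ht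
    · obtain ⟨t, rfl⟩ : ∃ s, t = s + 1 := ⟨t - 1, by omega⟩
      have h1 := h.O_succ' t
      have h2 := h.odd (t + 1) ht
      have h3 := h.excl t (by omega)
      omega
    · rw [h.O_low ht]; exact hc.O_le t
  below := by
    obtain ⟨K, hK⟩ := hc.below
    exact ⟨K + 1, h.below_right hK⟩

theorem proper_left (h : Shift t₀ gE gO aE aO c c') (hc : c'.Proper) : c.Proper where
  E_zero := by rw [← h.E_low (by omega), hc.E_zero]
  e_zero := by rw [h.e_eq 0 (by omega), hc.e_zero]
  e_le t := by
    by_cases ht : t = t₀ + 1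
    · have h1 := h.e_high t (by omega)
      have h2 := h.e_start
      have h3 := h.start
      subst ht
      omega
    · rw [h.e_eq t ht]; exact hc.e_le t
  O_le t := by
    rcases Nat.lt_or_ge t₀ t with ht | ht
    · have h1 := h.O_eq t (by omega)
      have h2 := h.odd t ht
      have h3 := h.excl t (by omega)
      omega
    · rw [← h.O_low ht]; exact hc.O_le t
  below := by
    obtain ⟨K, hK⟩ := hc.below
    exact ⟨K, h.below_left hK⟩

theorem cap_iff (h : Shift t₀ gE gO aE aO c c') (hc : c.Proper) (hk : 2 ≤ k) :
    ((∀ t, c'.e t + c'.E t + c'.O t + c'.E (t + 1) + 1 ≤ k) ∧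
      ∀ t, 1 ≤ c'.P t → c'.E (t + 1) + 2 ≤ k) ↔
    ((∀ t, c.e t + c.E t + c.O t + c.E (t + 1) + 1 ≤ k) ∧
      ∀ t, 1 ≤ c.P t → c.E (t + 1) + 2 ≤ k) := by
  obtain ⟨K, hK⟩ := hc.below
  rw [cap_iff_kept hc hk hK, cap_iff_kept (h.proper_right hc) hk (h.below_right hK),
    h.kept_eq (by omega) hK, h.card_eq hK]

theorem kept_total_iff (h : Shift t₀ gE gO aE aO c c') :
    (∀ K, c'.Below K → ∀ r, 1 ≤ r → r < k → c'.kept r K = ∑ s ∈ Finset.Icc 1 r, N s) ↔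
      ∀ K, c.Below K → ∀ r, 1 ≤ r → r < k → c.kept r K = ∑ s ∈ Finset.Icc 1 r, N s := by
  constructor
  · intro H K hK r hr hrk
    rw [← h.kept_eq hr hK]
    exact H _ (h.below_right hK) r hr hrk
  · intro H K hK r hr hrk
    have hK' := h.below_left hK
    rw [kept_eq_of_below hK (h.below_right hK'), h.kept_eq hr hK']
    exact H _ hK' r hr hrk

/-- Moving the parts up stays in the set `setF k i N`. -/
theorem inF_right (h : Shift t₀ gE gO aE aO c c') (hc : c.InF k i N) (hk : 2 ≤ k) :
    c'.InF k i N :=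
  have hcap := (h.cap_iff hc.toProper hk).2 ⟨hc.cap, hc.cap_of_P⟩
  { h.proper_right hc.toProper with
    first := by
      rw [h.O_low (by omega), h.E_low (by omega)]
      exact hc.first
    cap := hcap.1
    cap_of_P := hcap.2
    small_P := fun t ht => by
      have htt : t ≤ t₀ := by
        by_contra hlt
        rw [h.P_high t (by omega)] at ht
        omega
      have hP : 0 < c.P t := by
        have h1 := h.P_eq t
        have h2 := h.P_start
        by_cases hteq : t = t₀
        · subst hteq; omega
        · rw [h1 hteq]; exact ht
      obtain ⟨s, hs, hs'⟩ := hc.small_P t hP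
      exact ⟨s, hs, by rwa [h.O_low (by omega), h.E_low (by omega)]⟩
    small_e := fun t ht => by
      have htt : t ≤ t₀ := by
        by_contra hlt
        rw [h.e_high t (by omega)] at ht
        omega
      obtain ⟨s, hs, hs'⟩ := hc.small_e t (by rwa [h.e_eq t (by omega)])
      exact ⟨s, hs, by rwa [h.O_low (by omega), h.E_low (by omega)]⟩
    kept_eq := h.kept_total_iff.2 hc.kept_eq }

/-- Moving the parts down stays in the set `setF k i N`, provided that the new bad part is not the
smallest one. -/
theorem inF_left (h : Shift t₀ gE gO aE aO c c') (hc : c'.InF k i N) (hk : 2 ≤ k)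
    (hpos : 0 < c'.kept 1 (t₀ + 1)) : c.InF k i N :=
  have hp := h.proper_left hc.toProper
  have hcap := (h.cap_iff hp hk).1 ⟨hc.cap, hc.cap_of_P⟩
  have hsmall : ∃ s, s ≤ t₀ ∧ 0 < c.O s + c.E s := by
    suffices H : ∃ s, s ≤ t₀ ∧ 0 < c'.O s + c'.E s by
      obtain ⟨s, hs, hs'⟩ := H
      exact ⟨s, hs, by rwa [← h.O_low (by omega), ← h.E_low (by omega)]⟩
    obtain ⟨s, hs, hs'⟩ := Finset.exists_ne_zero_of_sum_ne_zero hpos.ne'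
    have hs1 := Finset.mem_range.1 hs
    have h1 := c'.keptE_le 1 s
    have h2 := c'.keptO_le 1 s
    by_cases hE : 0 < c'.O s + c'.E s
    · exact ⟨s, by omega, hE⟩
    · by_cases hP : 0 < c'.P s
      · obtain ⟨u, hu, hu'⟩ := hc.small_P s hP
        exact ⟨u, by omega, hu'⟩
      · obtain ⟨u, hu, hu'⟩ := hc.small_e s (by omega)
        exact ⟨u, by omega, hu'⟩
  { hp with
    first := by
      rw [← h.O_low (by omega), ← h.E_low (by omega)]
      exact hc.first
    cap := hcap.1
    cap_of_P := hcap.2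
    small_P := fun t ht => by
      rcases Nat.lt_trichotomy t t₀ with hlt | rfl | hlt
      · obtain ⟨s, hs, hs'⟩ := hc.small_P t (by rwa [← h.P_eq t (by omega)])
        exact ⟨s, hs, by rwa [← h.O_low (by omega), ← h.E_low (by omega)]⟩
      · exact hsmall
      · rw [h.P_eq t (by omega), h.P_high t hlt] at ht
        omega
    small_e := fun t ht => by
      rcases Nat.lt_trichotomy t (t₀ + 1) with hlt | rfl | hlt
      · obtain ⟨s, hs, hs'⟩ := hc.small_e t (by rwa [← h.e_eq t (by omega)])
        exact ⟨s, hs, by rwa [← h.O_low (by omega), ← h.E_low (by omega)]⟩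
      · obtain ⟨s, hs, hs'⟩ := hsmall
        exact ⟨s, by omega, hs'⟩
      · rw [h.e_eq t (by omega), h.e_high t (by omega)] at ht
        omega
    kept_eq := h.kept_total_iff.1 hc.kept_eq }

/-- The position of the part that becomes good among the parts with mark `1`. -/
theorem badLE_iff (h : Shift t₀ gE gO aE aO c c') (hm : c'.kept 1 (t₀ + 1) = m) :
    BadLE m c' ∧ BadLE (m + 1) c ∧ ¬ BadLE m c := by
  have hmono := fun S T (hST : S ≤ T) => c'.kept_mono 1 hST
  have hs := h.kept_start 1
  have h0 := h.start
  refine ⟨⟨fun t ht => ?_, fun t ht => ?_⟩, ⟨fun t ht => ?_, fun t ht => ?_⟩, fun hbad => ?_⟩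
  · have htt : t ≤ t₀ := by
      by_contra hlt
      rw [h.P_high t (by omega)] at ht
      omega
    have := hmono (t + 1) (t₀ + 1) (by omega)
    omega
  · have htt : t ≤ t₀ := by
      by_contra hlt
      rw [h.e_high t (by omega)] at ht
      omega
    have h1 := hmono (t + 1) (t₀ + 1) (by omega)
    have h2 := c'.kept_succ 1 t
    omega
  · rcases Nat.lt_trichotomy t t₀ with hlt | rfl | hlt
    · rw [← h.kept_low 1 (by omega)]
      have := hmono (t + 1) (t₀ + 1) (by omega)
      omega
    · omega
    · rw [h.P_eq t (by omega), h.P_high t hlt] at ht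
      omega
  · rcases Nat.lt_trichotomy t (t₀ + 1) with hlt | rfl | hlt
    · rw [← h.kept_low 1 (by omega)]
      have := hmono t (t₀ + 1) (by omega)
      omega
    · have := h.e_start
      have := h.e_high (t₀ + 1) (by omega)
      omega
    · rw [h.e_eq t (by omega), h.e_high t (by omega)] at ht
      omega
  · have h1 := hbad.1 t₀
    have h2 := hbad.2 (t₀ + 1)
    have h3 := h.P_start
    have h4 := h.e_start
    have h5 := h.e_high (t₀ + 1) (by omega)
    omega

end Shift

theorem kept_one_eq (hc : c.InF k i N) (hk : 2 ≤ k) {K : ℕ} (hK : c.Below K) :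
    c.kept 1 K = N 1 := by
  have := hc.kept_eq K hK 1 le_rfl (by omega)
  simpa using this

/-- If the last bad part is the part number `m + 1` among those with mark `1`, then it can be made
good by moving the last `N 1 - m` parts with mark `1`. -/
theorem exists_image (hc : c.InF k i N) (hk : 2 ≤ k) (hle : BadLE (m + 1) c)
    (hm : ¬ BadLE m c) : ∃ t₀ gE gO aE aO c', Shift t₀ gE gO aE aO c c' ∧ c'.InF k i N ∧
      BadLE m c' ∧ ∀ K, c.Below K → moved aE aO K + m = N 1 := by
  suffices H : ∃ t₀, (0 < c.P t₀ ∧ c.e (t₀ + 1) = 0 ∧ c.kept 1 (t₀ + 1) = m + 1 ∨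
      0 < c.e (t₀ + 1) ∧ c.kept 1 (t₀ + 1) = m) ∧
      (∀ t, t₀ + 1 < t → c.e t = 0) ∧ ∀ t, t₀ < t → c.P t = 0 by
    obtain ⟨t₀, h1, h2, h3⟩ := H
    obtain ⟨gE, gO, aE, aO, c', h⟩ := exists_shift hc.toProper (t₀ := t₀) (by omega) h2 h3
    have hkept : c'.kept 1 (t₀ + 1) = m := by
      have k1 := h.kept_start 1
      have k2 := h.start
      have k3 := h.e_start
      have k4 := h.e_high (t₀ + 1) (by omega)
      omega
    refine ⟨t₀, gE, gO, aE, aO, c', h, h.inF_right hc hk, (h.badLE_iff hkept).1, fun K hK => ?_⟩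
    have k1 := h.kept_one (h.lt_of_below hK)
    have k2 := h.a_eq_zero hK le_rfl
    have k3 := kept_one_eq hc hk hK
    omega
  rw [BadLE, not_and_or] at hm
  push Not at hm
  have hmono := fun S T (hST : S ≤ T) => c.kept_mono 1 hST
  have hsucc := c.kept_succ 1
  rcases hm with ⟨t, ht, htm⟩ | ⟨t, ht, htm⟩
  · have h0 := hle.1 t ht
    have he : ∀ s, t < s → c.e s = 0 := by
      intro s hs
      by_contra hne
      have h1 := hle.2 s (by omega)
      have h2 := hmono (t + 1) s (by omega)
      omega
    refine ⟨t, Or.inl ⟨ht, he _ (by omega), by omega⟩, fun s hs => he s (by omega), fun s hs => ?_⟩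
    by_contra hne
    have h1 := hle.1 s (by omega)
    have h2 := hmono (t + 1) s (by omega)
    have h3 := hsucc s
    omega
  · have h0 := hle.2 t ht
    have h00 := hc.e_zero
    obtain ⟨t, rfl⟩ : ∃ s, t = s + 1 := by
      rcases t with _ | t
      · omega
      · exact ⟨t, rfl⟩
    refine ⟨t, Or.inr ⟨ht, by omega⟩, fun s hs => ?_, fun s hs => ?_⟩
    · by_contra hne
      have h1 := hle.2 s (by omega)
      have h2 := hmono (t + 1 + 1) s (by omega)
      have h3 := hsucc (t + 1)
      omega
    · by_contra hne
      have h1 := hle.1 s (by omega)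
      have h2 := hmono (t + 1) s (by omega)
      have h3 := hsucc s
      rcases Nat.eq_or_lt_of_le (show t + 1 ≤ s from hs) with rfl | hlt
      · omega
      · have h4 := hmono (t + 1 + 1) s (by omega)
        have h5 := hsucc (t + 1)
        omega

/-- From some block `z` on there are no bad parts, and the scan from below still keeps `p` parts
there, if all bad parts come before the last `p` parts with mark `1`. -/
theorem exists_good_tail {p K : ℕ} (hc : c.Proper) (hK : c.Below K) (hm : 1 ≤ m)
    (hbad : BadLE m c) (htot : c.kept 1 K = m + p) :
    ∃ z, (∀ t, z < t → c.e t = 0) ∧ (∀ t, z < t → c.P t = 0) ∧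
      p ≤ ∑ s ∈ Finset.Ico z K, (c.keptO 1 (s + 1) + c.keptE 1 (s + 2)) := by
  -- above the last bad part, all parts with mark `1` are good
  have count : ∀ z, (∀ t, z < t → c.e t = 0) → (∀ t, z < t → c.P t = 0) → ∀ T, z < T →
      c.kept 1 T + c.keptE 1 T + c.keptO 1 T + c.keptE 1 (T + 1) =
        c.kept 1 (z + 1) + c.keptE 1 (z + 1) +
          ∑ s ∈ Finset.Ico z T, (c.keptO 1 (s + 1) + c.keptE 1 (s + 2)) := by
    intro z he hP T hT
    induction T, hT using Nat.le_induction with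
    | base =>
      simp only [Nat.succ_eq_add_one]
      rw [Finset.sum_Ico_succ_top (le_refl z), Finset.Ico_self, Finset.sum_empty]
      simp only [show z + 1 + 1 = z + 2 by omega]
      omega
    | succ T hT ih =>
      have h1 := he T hT
      have h2 := hP T hT
      rw [Finset.sum_Ico_succ_top (by omega), kept_succ]
      simp only [show T + 1 + 1 = T + 2 by omega] at *
      omega
  have tail : ∀ z, (∀ t, z < t → c.e t = 0) → (∀ t, z < t → c.P t = 0) →
      m + p ≤ c.kept 1 (z + 1) + c.keptE 1 (z + 1) +
          ∑ s ∈ Finset.Ico z K, (c.keptO 1 (s + 1) + c.keptE 1 (s + 2)) := by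
    intro z he hP
    have h1 := count z he hP (max K (z + 1)) (by omega)
    have h2 := kept_of_below hK 1 (le_max_left K (z + 1))
    have h3 : ∑ s ∈ Finset.Ico z (max K (z + 1)), (c.keptO 1 (s + 1) + c.keptE 1 (s + 2)) =
        ∑ s ∈ Finset.Ico z K, (c.keptO 1 (s + 1) + c.keptE 1 (s + 2)) := by
      refine (Finset.sum_subset (Finset.Ico_subset_Ico_right (le_max_left _ _))
        fun s hs hs' => ?_).symm
      rw [Finset.mem_Ico] at hs hs'
      have k1 := hK (s + 1) (by omega)
      have k2 := hK (s + 2) (by omega)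
      have k3 := c.keptO_le 1 (s + 1)
      have k4 := c.keptE_le 1 (s + 2)
      omega
    omega
  by_cases hex : ∃ t, 0 < c.e t + c.P t
  · obtain ⟨z, hz, hlast⟩ : ∃ z, 0 < c.e z + c.P z ∧ ∀ t, z < t → c.e t + c.P t = 0 := by
      classical
      have hfin : ∀ t, 0 < c.e t + c.P t → t ≤ K := by
        intro t ht
        by_contra hlt
        have := hK t (by omega)
        omega
      obtain ⟨t, ht⟩ := hex
      have hspec := Nat.findGreatest_spec (P := fun t => 0 < c.e t + c.P t) (hfin t ht) ht
      refine ⟨_, hspec, fun s hs => ?_⟩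
      by_contra hne
      exact Nat.findGreatest_is_greatest hs (hfin s (by omega)) (by omega)
    have he : ∀ t, z < t → c.e t = 0 := fun t ht => by have := hlast t ht; omega
    have hP : ∀ t, z < t → c.P t = 0 := fun t ht => by have := hlast t ht; omega
    refine ⟨z, he, hP, ?_⟩
    have h1 := tail z he hP
    have h2 : c.keptE 1 (z + 1) = 0 := by rw [keptE_succ]; omega
    suffices h3 : c.kept 1 (z + 1) ≤ m by omega
    by_cases hPz : 0 < c.P z
    · exact hbad.1 z hPz
    · have h3 := hbad.2 z (by omega)
      have h4 := hc.e_le z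
      have h5 : c.keptE 1 z = 0 := by
        rcases z with _ | z
        · rfl
        · rw [keptE_succ]; omega
      have h6 : c.keptO 1 z = 0 := by rw [keptO]; omega
      rw [kept_succ]
      omega
  · push Not at hex
    have he : ∀ t, c.e t = 0 := fun t => by have := hex t; omega
    have hP : ∀ t, c.P t = 0 := fun t => by have := hex t; omega
    refine ⟨0, fun t _ => he t, fun t _ => hP t, ?_⟩
    have h1 := tail 0 (fun t _ => he t) fun t _ => hP t
    have h2 : c.kept 1 (0 + 1) + c.keptE 1 (0 + 1) ≤ 1 := by
      have h3 := he 0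
      have h4 := hP 0
      have h5 : c.kept 1 0 = 0 := rfl
      have h6 := c.keptE_zero 1
      rw [kept_succ, keptE_succ]
      have h7 : c.keptO 1 0 ≤ 1 := by rw [keptO]; omega
      omega
    omega

/-- If all bad parts come before the last `N 1 - m` parts with mark `1`, then `N 1 - m` good parts
can be moved down, the smallest of them becoming bad. -/
theorem exists_preimage (hc : c'.InF k i N) (hk : 2 ≤ k) (hm : 1 ≤ m) (hmN : m < N 1)
    (hle : BadLE m c') : ∃ t₀ gE gO aE aO c, Shift t₀ gE gO aE aO c c' ∧ c.InF k i N ∧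
      BadLE (m + 1) c ∧ ¬ BadLE m c ∧ ∀ K, c.Below K → moved aE aO K + m = N 1 := by
  obtain ⟨K, hK⟩ := hc.below
  have htot := kept_one_eq hc hk hK
  obtain ⟨z, he, hP, hz⟩ := exists_good_tail (p := N 1 - m) hc.toProper hK hm hle (by omega)
  obtain ⟨bE, bO, hO, hE⟩ := exists_scan_above c' hK
  have hle1 : ∀ t, bO (t + 1) + bE (t + 2) ≤ 1 := by
    intro t
    have h1 := hO (t + 1)
    have h2 := hE (t + 2)
    simp only [show t + 1 + 1 = t + 2 by omega] at *
    split_ifs at h1 h2 <;> omega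
  obtain ⟨t₀, hzt, htK, hstart, hsum⟩ := exists_tail_sum (u := fun t => bO (t + 1) + bE (t + 2))
    hle1 (show 1 ≤ N 1 - m by omega) (hz.trans (sum_kept_le_sum_scan hK hO hE z))
  obtain ⟨gE, gO, aE, aO, c, h, ha⟩ := exists_shift_of_scan hc.toProper hO hE hstart
    (fun t ht => he t (by omega)) fun t ht => hP t (by omega)
  have hKc := h.below_left hK
  have hmoved : moved aE aO K = N 1 - m := by
    rw [h.moved_eq_Ico, ← hsum]
    exact Finset.sum_congr rfl fun t ht => ha t (Finset.mem_Ico.1 ht).1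
  have hkept : c'.kept 1 (t₀ + 1) = m := by
    have h1 := h.kept_one (h.lt_of_below hKc)
    have h2 := h.a_eq_zero hKc le_rfl
    have h3 := h.kept_eq le_rfl hKc
    have h4 := kept_of_below hK 1 (Nat.le_succ K)
    simp only [Nat.succ_eq_add_one] at h4
    omega
  have hF := h.inF_left hc hk (by omega)
  obtain ⟨-, k2, k3⟩ := h.badLE_iff hkept
  refine ⟨t₀, gE, gO, aE, aO, c, h, hF, k2, k3, fun L hL => ?_⟩
  have h1 := h.kept_one (h.lt_of_below hL)
  have h2 := h.a_eq_zero hL le_rfl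
  have h3 := kept_one_eq hF hk hL
  omega

/-- There are `N 1` parts with mark `1`, and the bad parts are among them. -/
theorem InF.badLE_total (hc : c.InF k i N) (hk : 2 ≤ k) : BadLE (N 1) c := by
  obtain ⟨K, hK⟩ := hc.below
  have htot := kept_one_eq hc hk hK
  refine ⟨fun t ht => ?_, fun t ht => ?_⟩
  · have h1 := kept_of_below hK 1 (le_max_left K (t + 1))
    have h2 := c.kept_mono 1 (le_max_right K (t + 1))
    omega
  · have h1 := kept_of_below hK 1 (le_max_left K (t + 1))
    have h2 := c.kept_mono 1 (le_max_right K (t + 1))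
    have h3 := c.kept_succ 1 t
    omega

/-- The first part is good and carries the mark `1`. -/
theorem InF.bad_eq_zero (hc : c.InF k i N) (hle : BadLE 1 c) (t : ℕ) : c.e t = 0 ∧ c.P t = 0 := by
  have hpos : ∀ s, 0 < c.O s + c.E s → 0 < c.kept 1 (s + 1) := by
    intro s hs
    have h1 := c.kept_succ 1 s
    by_cases hE : c.keptE 1 s = 0
    · by_cases hO : c.keptO 1 s = 0
      · rw [keptO] at hO
        by_cases hes : c.e s = 0
        · rcases s with _ | s
          · have := hc.E_zero
            omega
          · rw [keptE_succ] at hE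
            have h2 := c.kept_succ 1 s
            omega
        · omega
      · omega
    · omega
  constructor
  · by_contra hne
    obtain ⟨s, hs, hs'⟩ := hc.small_e t (by omega)
    have h1 := hpos s hs'
    have h2 := c.kept_mono 1 (show s + 1 ≤ t from hs)
    have h3 := hle.2 t (by omega)
    omega
  · by_contra hne
    obtain ⟨s, hs, hs'⟩ := hc.small_P t (by omega)
    have h1 := hle.1 t (by omega)
    have h2 := c.kept_succ 1 t
    rcases Nat.eq_or_lt_of_le hs with rfl | hlt
    · have h4 : c.kept 1 s + c.e s + c.keptE 1 s + c.keptO 1 s = 0 := by omega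
      have h5 : c.keptO 1 s = 0 := by omega
      rw [keptO] at h5
      rcases s with _ | s
      · have := hc.E_zero
        omega
      · have h6 : c.keptE 1 (s + 1) = 0 := by omega
        rw [keptE_succ] at h6
        have h7 := c.kept_succ 1 s
        omega
    · have h3 := hpos s hs'
      have h4 := c.kept_mono 1 (show s + 1 ≤ t from hlt)
      omega

end Conf

/-! ### Least unused marks -/

theorem leastUnused_eq_iff (l : List ℕ) (m : ℕ) :
    leastUnused l = m ↔ (1 ≤ m ∧ m ∉ l) ∧ ∀ s, 1 ≤ s → s < m → s ∈ l := by
  rw [leastUnused, Nat.find_eq_iff]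
  refine and_congr_right fun _ => ⟨fun h s hs hsm => ?_, fun h s hsm hs => hs.2 (h s hs.1 hsm)⟩
  by_contra hsl
  exact h s hsm ⟨hs, hsl⟩

theorem leastUnused_spec (l : List ℕ) : 1 ≤ leastUnused l ∧ leastUnused l ∉ l :=
  ((leastUnused_eq_iff l _).1 rfl).1

theorem leastUnused_congr {l l' : List ℕ} (h : ∀ a, a ∈ l ↔ a ∈ l') :
    leastUnused l = leastUnused l' := by
  rw [leastUnused_eq_iff]
  obtain ⟨h1, h2⟩ := (leastUnused_eq_iff l' _).1 rfl
  exact ⟨⟨h1.1, (h _).not.2 h1.2⟩, fun s hs hsm => (h s).2 (h2 s hs hsm)⟩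

/-- The number of elements of `{1, …, r}` that occur in `l`. -/
def usedUpTo (r : ℕ) (l : List ℕ) : ℕ := ((Finset.Icc 1 r).filter (· ∈ l)).card

theorem usedUpTo_congr {l l' : List ℕ} (r : ℕ) (h : ∀ a, a ∈ l ↔ a ∈ l') :
    usedUpTo r l = usedUpTo r l' := by
  rw [usedUpTo, usedUpTo, Finset.filter_congr fun a _ => h a]

theorem usedUpTo_le (r : ℕ) (l : List ℕ) : usedUpTo r l ≤ r := by
  refine (Finset.card_filter_le _ _).trans ?_
  rw [Nat.card_Icc, Nat.add_sub_cancel]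

theorem usedUpTo_eq_countP {l : List ℕ} (hl : l.Nodup) (hpos : ∀ a ∈ l, 1 ≤ a) (r : ℕ) :
    usedUpTo r l = l.countP (· ≤ r) := by
  rw [usedUpTo, List.countP_eq_length_filter, ← List.toFinset_card_of_nodup (hl.filter _)]
  congr 1
  ext a
  simp only [Finset.mem_filter, Finset.mem_Icc, List.mem_toFinset, List.mem_filter,
    decide_eq_true_eq]
  exact ⟨fun h => ⟨h.2, h.1.2⟩, fun h => ⟨⟨hpos a h.1, h.2⟩, h.1⟩⟩

theorem usedUpTo_append_of_disjoint {l l' : List ℕ} (r : ℕ) (h : ∀ a ∈ l, a ∉ l') :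
    usedUpTo r (l ++ l') = usedUpTo r l + usedUpTo r l' := by
  rw [usedUpTo, usedUpTo, usedUpTo, ← Finset.card_union_of_disjoint]
  · congr 1
    ext a
    simp only [Finset.mem_filter, Finset.mem_union, List.mem_append]
    tauto
  · refine Finset.disjoint_filter.2 fun a _ ha => h a ha

theorem leastUnused_le_iff (l : List ℕ) (r : ℕ) : leastUnused l ≤ r ↔ usedUpTo r l < r := by
  have hcard : (Finset.Icc 1 r).card = r := by rw [Nat.card_Icc, Nat.add_sub_cancel]
  obtain ⟨⟨h1, h2⟩, h3⟩ := (leastUnused_eq_iff l _).1 rfl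
  constructor
  · intro h
    conv_rhs => rw [← hcard]
    exact Finset.card_lt_card (Finset.filter_ssubset.2
      ⟨leastUnused l, Finset.mem_Icc.2 ⟨h1, h⟩, h2⟩)
  · intro h
    by_contra hlt
    have : usedUpTo r l = r := by
      rw [usedUpTo, Finset.filter_true_of_mem fun a ha => ?_, hcard]
      rw [Finset.mem_Icc] at ha
      exact h3 a ha.1 (by omega)
    omega

/-- Starting from the used marks `B`, the next `n` least unused marks, the last one first. -/
def addMarks (B : List ℕ) : ℕ → List ℕ
  | 0 => []
  | n + 1 => leastUnused (addMarks B n ++ B) :: addMarks B n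

theorem addMarks_succ (B : List ℕ) (n : ℕ) :
    addMarks B (n + 1) = leastUnused (addMarks B n ++ B) :: addMarks B n := rfl

theorem addMarks_spec (B : List ℕ) (n : ℕ) :
    (addMarks B n).Nodup ∧ (∀ a ∈ addMarks B n, 1 ≤ a) ∧ ∀ a ∈ addMarks B n, a ∉ B := by
  induction n with
  | zero => simp [addMarks]
  | succ n ih =>
    obtain ⟨h1, h2, h3⟩ := ih
    have h := leastUnused_spec (addMarks B n ++ B)
    simp only [List.mem_append, not_or] at h
    rw [addMarks_succ]
    refine ⟨List.nodup_cons.2 ⟨h.2.1, h1⟩, ?_, ?_⟩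
    · rintro a (_ | ⟨_, ha⟩)
      · exact h.1
      · exact h2 a ha
    · rintro a (_ | ⟨_, ha⟩)
      · exact h.2.2
      · exact h3 a ha

theorem addMarks_subset (B : List ℕ) {m n : ℕ} (h : m ≤ n) : addMarks B m ⊆ addMarks B n := by
  induction n, h using Nat.le_induction with
  | base => exact List.Subset.refl _
  | succ n _ ih => exact fun a ha => List.mem_cons_of_mem _ (ih ha)

theorem countP_addMarks (B : List ℕ) (n r : ℕ) :
    (addMarks B n).countP (· ≤ r) = min n (r - usedUpTo r B) := by
  induction n with
  | zero => simp [addMarks]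
  | succ n ih =>
    obtain ⟨h1, h2, h3⟩ := addMarks_spec B n
    have h4 := leastUnused_le_iff (addMarks B n ++ B) r
    rw [usedUpTo_append_of_disjoint r h3, usedUpTo_eq_countP h1 h2, ih] at h4
    have h5 := usedUpTo_le r B
    rw [addMarks_succ, List.countP_cons, ih]
    by_cases h : leastUnused (addMarks B n ++ B) ≤ r
    · have := h4.1 h
      simp only [h, decide_true, if_true]
      omega
    · have := fun h' => h (h4.2 h')
      simp only [h, decide_false]
      simp only [Bool.false_eq_true, if_false]
      omega

/-- If `1` is used, but none of `2, …, g`, then these are the next marks. -/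
theorem mem_addMarks_of_gap {B : List ℕ} {g : ℕ} (h1 : 1 ∈ B) (hg : ∀ a, 2 ≤ a → a ≤ g → a ∉ B)
    {j : ℕ} (hj : j + 1 ≤ g) (a : ℕ) : a ∈ addMarks B j ↔ 2 ≤ a ∧ a ≤ j + 1 := by
  induction j generalizing a with
  | zero => simp [addMarks]; omega
  | succ j ih =>
    have ih := ih (by omega)
    have h2 : leastUnused (addMarks B j ++ B) = j + 2 := by
      rw [leastUnused_eq_iff]
      simp only [List.mem_append, ih]
      refine ⟨⟨by omega, ?_⟩, fun s hs hsj => ?_⟩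
      · have := hg (j + 2) (by omega) (by omega)
        simp only [this, or_false]
        omega
      · rcases Nat.eq_or_lt_of_le hs with rfl | hs
        · exact Or.inr h1
        · left; omega
    rw [addMarks_succ, h2, List.mem_cons, ih]
    omega

theorem leastUsed_spec {l : List ℕ} (h : l ≠ []) : leastUsed l ∈ l ∧ ∀ a ∈ l, leastUsed l ≤ a := by
  obtain ⟨m, hm⟩ := Option.isSome_iff_exists.1 (List.isSome_min?_of_ne_nil h)
  rw [leastUsed, hm]
  exact List.min?_eq_some_iff.1 hm

/-! ### Marking the parts of one size -/

theorem marksWhere_append (l l' : List (OPart × ℕ)) (P : OPart → Prop) [DecidablePred P] :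
    marksWhere (l ++ l') P = marksWhere l P ++ marksWhere l' P := by
  rw [marksWhere, List.filter_append, List.map_append]; rfl

theorem marksWhere_congr {l : List (OPart × ℕ)} {P Q : OPart → Prop} [DecidablePred P]
    [DecidablePred Q] (h : ∀ y ∈ l, P y.1 ↔ Q y.1) : marksWhere l P = marksWhere l Q := by
  rw [marksWhere, marksWhere]
  congr 1
  exact List.filter_congr fun y hy => by simp [h y hy]

theorem marksWhere_of_forall {l : List (OPart × ℕ)} {P : OPart → Prop} [DecidablePred P]
    (h : ∀ y ∈ l, P y.1) : marksWhere l P = l.map Prod.snd := by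
  rw [marksWhere, List.filter_eq_self.2 fun y hy => by simp [h y hy]]

theorem marksWhere_of_forall_not {l : List (OPart × ℕ)} {P : OPart → Prop} [DecidablePred P]
    (h : ∀ y ∈ l, ¬ P y.1) : marksWhere l P = [] := by
  rw [marksWhere, List.filter_eq_nil_iff.2 fun y hy => by simp [h y hy], List.map_nil]

/-- One step of the marking. -/
def markStep (lam : List OPart) (prev : List (OPart × ℕ)) (x : OPart) : List (OPart × ℕ) :=
  (x, nextMark lam prev x) :: prev

theorem nextMark_pl_odd (lam : List OPart) (prev : List (OPart × ℕ)) (t : ℕ) :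
    nextMark lam prev (pl (2 * t + 1)) = 1 := by
  simp [nextMark, pl]

theorem nextMark_ov_even (lam : List OPart) (prev : List (OPart × ℕ)) (t : ℕ) :
    nextMark lam prev (ov (2 * t + 2)) = 1 := by
  have h1 : Even (2 * t + 2) := ⟨t + 1, by omega⟩
  simp [nextMark, ov, h1]

theorem leastUnused_nil : leastUnused [] = 1 := by
  rw [leastUnused_eq_iff]
  refine ⟨⟨le_rfl, by simp⟩, by omega⟩

theorem nextMark_ov_odd (lam : List OPart) (prev : List (OPart × ℕ)) (t : ℕ) :
    nextMark lam prev (ov (2 * t + 1)) =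
      leastUnused (marksWhere prev (fun y => y.size = 2 * t)) := by
  have h1 : ¬ Even (2 * t + 1) := by rw [Nat.not_even_iff_odd]; exact ⟨t, rfl⟩
  have h2 : Odd (2 * t + 1) := ⟨t, rfl⟩
  rw [nextMark]
  simp only [ov, h1, h2]
  by_cases hp : prev = []
  · subst hp
    simp [marksWhere, leastUnused_nil]
  · simp only [hp, if_false, Bool.true_eq_false, and_false, false_and, if_true]
    exact congrArg leastUnused (marksWhere_congr fun y _ => by omega)

theorem foldl_markStep_of_one {lam : List OPart} {x : OPart}
    (h : ∀ prev, nextMark lam prev x = 1) (n : ℕ) (prev : List (OPart × ℕ)) :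
    (List.replicate n x).foldl (markStep lam) prev = List.replicate n (x, 1) ++ prev := by
  induction n with
  | zero => rfl
  | succ n ih =>
    rw [List.replicate_succ', List.foldl_append, ih, List.foldl_cons, List.foldl_nil, markStep, h,
      List.replicate_succ, List.cons_append]

theorem foldl_markStep_of_addMarks {lam : List OPart} {x : OPart} {B : List ℕ}
    {prev : List (OPart × ℕ)}
    (h : ∀ j, nextMark lam ((addMarks B j).map (fun a => (x, a)) ++ prev) x =
      leastUnused (addMarks B j ++ B)) (n : ℕ) :
    (List.replicate n x).foldl (markStep lam) prev =
      (addMarks B n).map (fun a => (x, a)) ++ prev := by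
  induction n with
  | zero => rfl
  | succ n ih =>
    rw [List.replicate_succ', List.foldl_append, ih, List.foldl_cons, List.foldl_nil, markStep, h,
      addMarks_succ, List.map_cons, List.cons_append]

/-- The mark of a non-overlined even part after `j` equal parts that got the marks `A`. Here `M`
contains the marks of the parts that are smaller by `2`, and `D` those of the smaller or overlined
parts in between. -/
theorem nextMark_pl_even {lam : List OPart} {prev : List (OPart × ℕ)} {t : ℕ} {A D M : List ℕ}
    (hlt : ∀ y ∈ prev, y.1.size ≤ 2 * t + 2)
    (hM : marksWhere prev (fun y => y.size = 2 * t) = M)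
    (hD : marksWhere prev (fun y => 2 * t ≤ y.size) = D) :
    nextMark lam (A.map (fun a => (pl (2 * t + 2), a)) ++ prev) (pl (2 * t + 2)) =
      if 2 ≤ leastUsed M ∧ (A.head?.or (prev.head?.map Prod.snd)) = some (leastUsed M - 1) ∧
        (pl (2 * t + 1) ∈ lam ∨ ov (2 * t + 2) ∈ lam) ∧ ov (2 * t + 1) ∉ lam
      then leastUsed M else leastUnused (A ++ D) := by
  have h1 : Even (2 * t + 2) := ⟨t + 1, by omega⟩
  have h2 : ¬ Odd (2 * t + 2) := by rwa [Nat.not_odd_iff_even]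
  have eA : ∀ y ∈ A.map (fun a => (pl (2 * t + 2), a)), y.1.size = 2 * t + 2 := by
    intro y hy
    obtain ⟨a, _, rfl⟩ := List.mem_map.1 hy
    rfl
  have e1 : marksWhere (A.map (fun a => (pl (2 * t + 2), a)) ++ prev)
      (fun y => (pl (2 * t + 2)).size ≤ y.size + 2) = A ++ D := by
    rw [marksWhere_append, marksWhere_of_forall, List.map_map, ← hD]
    · congr 1
      · exact List.map_id A
      · exact marksWhere_congr fun y _ => by simp only [pl]; omega
    · intro y hy
      rw [eA y hy]
      simp only [pl]
      omega
  have e2 : marksWhere (A.map (fun a => (pl (2 * t + 2), a)) ++ prev)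
      (fun y => y.size + 2 = (pl (2 * t + 2)).size) = M := by
    rw [marksWhere_append, marksWhere_of_forall_not, List.nil_append, ← hM]
    · exact marksWhere_congr fun y _ => by simp only [pl]; omega
    · intro y hy
      rw [eA y hy]
      simp only [pl]
      omega
  have e3 : (A.map (fun a => (pl (2 * t + 2), a)) ++ prev).head?.map Prod.snd =
      A.head?.or (prev.head?.map Prod.snd) := by
    rcases A with _ | ⟨a, A⟩ <;> simp
  rw [nextMark, e1, e2, e3]
  by_cases hp : A.map (fun a => (pl (2 * t + 2), a)) ++ prev = []
  · rw [if_pos hp]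
    obtain ⟨hA, hprev⟩ := List.append_eq_nil_iff.1 hp
    rw [List.map_eq_nil_iff] at hA
    subst hA hprev
    have hD' : D = [] := hD.symm
    subst hD'
    simp [leastUnused_nil]
  · rw [if_neg hp]
    simp only [pl, h1, h2]
    simp only [false_and, if_false, Bool.false_eq_true, and_false, ov]
    rfl

/-! ### The marking and the greedy scans -/

/-- The exceptional case of the marking: if a bad part lies between the parts with the marks `M` and
the parts to be marked, and `M` is not empty and does not contain `1`, then the least element `g`
of `M` is not available up to the marks `2, …, g - 1`, but becomes available afterwards. In effect,
the marks in use are `1` and those in `M` other than `g`. -/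
theorem exceptional_mark {M A D : List ℕ} {h₀ : Option ℕ} {g : ℕ} {bad : Prop} [Decidable bad]
    (hM : M.Nodup) (hbad : bad) (hg : g = leastUsed M) (hg2 : 2 ≤ g) (hne : M ≠ [])
    (hD : ∀ a, a ∈ D ↔ a = 1 ∨ a ∈ M) (hh : h₀ = some 1) (j : ℕ)
    (hA : A = addMarks (1 :: M.erase g) j) :
    (if 2 ≤ g ∧ A.head?.or h₀ = some (g - 1) ∧ bad then g else leastUnused (A ++ D)) =
      leastUnused (A ++ (1 :: M.erase g)) := by
  obtain ⟨hgM, hmin⟩ := leastUsed_spec hne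
  rw [← hg] at hgM hmin
  have hmem : ∀ a, a ∈ 1 :: M.erase g ↔ a = 1 ∨ a ∈ M ∧ a ≠ g := by
    intro a
    rw [List.mem_cons, hM.mem_erase_iff]
    tauto
  have hgap : ∀ a, 2 ≤ a → a ≤ g → a ∉ 1 :: M.erase g := by
    intro a h2 hag ha
    rcases (hmem a).1 ha with h | ⟨h, hne⟩
    · omega
    · have := hmin a h
      omega
  have hfirst := fun {j} => mem_addMarks_of_gap (j := j) (List.mem_cons_self) hgap
  have hnext : ∀ j, j + 2 ≤ g → leastUnused (addMarks (1 :: M.erase g) j ++ (1 :: M.erase g)) =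
      j + 2 := by
    intro j hj
    rw [leastUnused_eq_iff]
    simp only [List.mem_append, hfirst (show j + 1 ≤ g by omega)]
    refine ⟨⟨by omega, ?_⟩, fun s hs hsj => ?_⟩
    · have := hgap (j + 2) (by omega) hj
      simp only [this, or_false]
      omega
    · rcases Nat.eq_or_lt_of_le hs with rfl | hs
      · exact Or.inr List.mem_cons_self
      · left; omega
  -- the mark of the preceding part
  have hhead : A.head?.or h₀ = some (g - 1) ↔ j + 2 = g := by
    subst hA hh
    rcases j with _ | j
    · simp only [addMarks, List.head?_nil, Option.none_or, Option.some.injEq]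
      omega
    · rw [addMarks_succ, List.head?_cons, Option.some_or, Option.some.injEq]
      by_cases hj : j + 2 ≤ g
      · rw [hnext j hj]
        omega
      · have hspec := (leastUnused_spec (addMarks (1 :: M.erase g) j ++ (1 :: M.erase g))).2
        refine ⟨fun h => ?_, fun h => by omega⟩
        rw [h, List.mem_append, not_or] at hspec
        by_cases h3 : g = 2
        · subst h3
          exact absurd List.mem_cons_self hspec.2
        · exact absurd (addMarks_subset _ (show g - 2 ≤ j by omega)
            ((hfirst (show g - 2 + 1 ≤ g by omega) (g - 1)).2 (by omega))) hspec.1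
  by_cases hj : j + 2 = g
  · rw [if_pos ⟨hg2, hhead.2 hj, hbad⟩, hA, hnext j (by omega), hj]
  · rw [if_neg fun h => hj (hhead.1 h.2.1)]
    by_cases hlt : j + 2 < g
    · rw [hA, hnext j (by omega), leastUnused_eq_iff]
      simp only [List.mem_append, hfirst (show j + 1 ≤ g by omega), hD]
      refine ⟨⟨by omega, ?_⟩, fun s hs hsj => ?_⟩
      · intro h
        rcases h with h | h | h
        · omega
        · omega
        · have := hmin _ h
          omega
      · omega
    · refine leastUnused_congr fun a => ?_
      rw [List.mem_append, List.mem_append, hD, hmem]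
      have hgA : g ∈ A := by
        rw [hA]
        exact addMarks_subset _ (show g - 1 ≤ j by omega)
          ((hfirst (show g - 1 + 1 ≤ g by omega) g).2 (by omega))
      by_cases hag : a = g
      · subst hag
        simp [hgA]
      · simp [hag]

/-- The number of marks up to `r` that are not available in the exceptional case. -/
theorem usedUpTo_exceptional {M : List ℕ} (hM : M.Nodup) (hpos : ∀ a ∈ M, 1 ≤ a) (hne : M ≠ [])
    (h1 : 1 ∉ M) {r : ℕ} (hr : 1 ≤ r) :
    usedUpTo r (1 :: M.erase (leastUsed M)) = max (usedUpTo r M) 1 := by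
  obtain ⟨hgM, hmin⟩ := leastUsed_spec hne
  generalize leastUsed M = g at *
  have hnd : (1 :: M.erase g).Nodup :=
    List.nodup_cons.2 ⟨fun h => h1 (List.mem_of_mem_erase h), hM.erase g⟩
  rw [usedUpTo_eq_countP hnd, usedUpTo_eq_countP hM hpos, List.countP_cons,
    (List.perm_cons_erase hgM).countP_eq, List.countP_cons]
  · have hd : decide (1 ≤ r) = true := decide_eq_true hr
    rw [hd, if_pos rfl]
    by_cases hgr : g ≤ r
    · rw [decide_eq_true hgr, if_pos rfl]
      omega
    · have h0 : (M.erase g).countP (· ≤ r) = 0 := by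
        rw [List.countP_eq_zero]
        intro a ha
        have := hmin a (List.mem_of_mem_erase ha)
        simp only [decide_eq_true_eq]
        omega
      rw [h0, decide_eq_false hgr]
      simp
  · rintro a (_ | ⟨_, ha⟩)
    · exact le_rfl
    · exact hpos a (List.mem_of_mem_erase ha)

namespace Conf

/-- The parts of size `2t + 1` and `2t + 2`, in increasing order. -/
def block (c : Conf) (t : ℕ) : List OPart :=
  List.replicate (c.O t) (ov (2 * t + 1)) ++ (List.replicate (c.P t) (pl (2 * t + 1)) ++
    (List.replicate (c.e (t + 1)) (ov (2 * t + 2)) ++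
      List.replicate (c.E (t + 1)) (pl (2 * t + 2))))

/-- The parts of size up to `2T`, in increasing order. -/
def toList (c : Conf) : ℕ → List OPart
  | 0 => []
  | T + 1 => toList c T ++ c.block T

/-- What is known about the list `prev` of the marked parts of size up to `2T`. -/
structure MarkInv (c : Conf) (T : ℕ) (prev : List (OPart × ℕ)) : Prop where
  size_le : ∀ y ∈ prev, y.1.size ≤ 2 * T
  pos : ∀ y ∈ prev, 1 ≤ y.2
  nodup : (marksWhere prev (fun y => y.size = 2 * T)).Nodup
  last : ∀ r, 1 ≤ r →
    usedUpTo r (marksWhere prev (fun y => y.size = 2 * T)) = c.e T + c.keptE r T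
  count : ∀ r, 1 ≤ r →
    (prev.map Prod.snd).countP (· ≤ r) = c.kept r T + (c.e T + c.keptE r T)

theorem pos_of_mem_marksWhere {prev : List (OPart × ℕ)} (h : ∀ y ∈ prev, 1 ≤ y.2)
    {P : OPart → Prop} [DecidablePred P] : ∀ a ∈ marksWhere prev P, 1 ≤ a := by
  intro a ha
  obtain ⟨y, hy, rfl⟩ := List.mem_map.1 ha
  exact h y (List.mem_of_mem_filter hy)

/-- The marking of the parts of size `2T + 1` and `2T + 2`. In all cases, the marks of the
non-overlined parts `2T + 2` are the least ones that are not in a list `B`, and the number of marks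
up to `r` in `B` is what the parts in the way take from the capacity `r` in `Conf.keptE`. -/
theorem MarkInv.succ {c : Conf} (hc : c.Proper) {T : ℕ} {prev : List (OPart × ℕ)}
    (h : c.MarkInv T prev) {lam : List OPart} (hov : ov (2 * T + 1) ∈ lam ↔ 0 < c.O T)
    (hpl : pl (2 * T + 1) ∈ lam ↔ 0 < c.P T) (hov' : ov (2 * T + 2) ∈ lam ↔ 0 < c.e (T + 1)) :
    c.MarkInv (T + 1) ((c.block T).foldl (markStep lam) prev) := by
  obtain ⟨M, hM⟩ : ∃ M, M = marksWhere prev (fun y => y.size = 2 * T) := ⟨_, rfl⟩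
  have hMnd := h.nodup
  have hMpos := pos_of_mem_marksWhere h.pos (P := fun y => y.size = 2 * T)
  have hMlast := h.last
  rw [← hM] at hMnd hMpos hMlast
  -- the overlined odd part
  obtain ⟨m, hm⟩ : ∃ m, m = leastUnused M := ⟨_, rfl⟩
  have hmspec := leastUnused_spec M
  rw [← hm] at hmspec
  obtain ⟨Q, hQ⟩ : ∃ Q, Q = List.replicate (c.O T) (ov (2 * T + 1), m) := ⟨_, rfl⟩
  have hO : (List.replicate (c.O T) (ov (2 * T + 1))).foldl (markStep lam) prev = Q ++ prev := by
    have := hc.O_le T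
    rcases (show c.O T = 0 ∨ c.O T = 1 by omega) with h0 | h0
    · rw [hQ, h0]; rfl
    · rw [hQ, h0, List.replicate_one, List.replicate_one, List.foldl_cons, List.foldl_nil,
        markStep, nextMark_ov_odd, ← hM, ← hm]
      rfl
  obtain ⟨R, hR⟩ : ∃ R, R = List.replicate (c.e (T + 1)) (ov (2 * T + 2), 1) ++
    (List.replicate (c.P T) (pl (2 * T + 1), 1) ++ (Q ++ prev)) := ⟨_, rfl⟩
  obtain ⟨D, hD⟩ : ∃ D, D = List.replicate (c.e (T + 1)) 1 ++
    (List.replicate (c.P T) 1 ++ (List.replicate (c.O T) m ++ M)) := ⟨_, rfl⟩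
  obtain ⟨M', hM'⟩ : ∃ M', M' = List.replicate (c.O T) m ++ M := ⟨_, rfl⟩
  have hQmem : ∀ y ∈ Q, y = (ov (2 * T + 1), m) := fun y hy => by
    rw [hQ] at hy; exact List.eq_of_mem_replicate hy
  have hRsize : ∀ y ∈ R, y.1.size ≤ 2 * T + 2 := by
    intro y hy
    rw [hR, List.mem_append, List.mem_append, List.mem_append] at hy
    rcases hy with hy | hy | hy | hy
    · rw [List.eq_of_mem_replicate hy]; simp [ov]
    · rw [List.eq_of_mem_replicate hy]; simp [pl]
    · rw [hQmem y hy]; simp [ov]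
    · have := h.size_le y hy
      omega
  have hRM : marksWhere R (fun y => y.size = 2 * T) = M := by
    rw [hR, marksWhere_append, marksWhere_append, marksWhere_append, ← hM,
      marksWhere_of_forall_not, marksWhere_of_forall_not, marksWhere_of_forall_not]
    · rfl
    · intro y hy; rw [hQmem y hy]; simp [ov]
    · intro y hy; rw [List.eq_of_mem_replicate hy]; simp [pl]
    · intro y hy; rw [List.eq_of_mem_replicate hy]; simp [ov]
  have hRD : marksWhere R (fun y => 2 * T ≤ y.size) = D := by
    rw [hR, marksWhere_append, marksWhere_append, marksWhere_append, hD,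
      marksWhere_of_forall, marksWhere_of_forall, marksWhere_of_forall, hM]
    · rw [List.map_replicate, List.map_replicate, hQ, List.map_replicate,
        marksWhere_congr (l := prev) (Q := fun y => y.size = 2 * T)]
      intro y hy
      have := h.size_le y hy
      omega
    · intro y hy; rw [hQmem y hy]; simp only [ov]; omega
    · intro y hy; rw [List.eq_of_mem_replicate hy]; simp only [pl]; omega
    · intro y hy; rw [List.eq_of_mem_replicate hy]; simp only [ov]; omega
  have hRtop : marksWhere R (fun y => y.size = 2 * T + 2) = List.replicate (c.e (T + 1)) 1 := by
    rw [hR, marksWhere_append, marksWhere_append, marksWhere_append,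
      marksWhere_of_forall, marksWhere_of_forall_not, marksWhere_of_forall_not,
      marksWhere_of_forall_not]
    · rw [List.map_replicate]
      simp
    · intro y hy; have := h.size_le y hy; omega
    · intro y hy; rw [hQmem y hy]; simp [ov]
    · intro y hy; rw [List.eq_of_mem_replicate hy]; simp [pl]
    · intro y hy; rw [List.eq_of_mem_replicate hy]; simp [ov]
  have hRsnd : R.map Prod.snd = List.replicate (c.e (T + 1)) 1 ++
      (List.replicate (c.P T) 1 ++ (List.replicate (c.O T) m ++ prev.map Prod.snd)) := by
    rw [hR, hQ]
    simp only [List.map_append, List.map_replicate]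
  have hRpos : ∀ y ∈ R, 1 ≤ y.2 := by
    intro y hy
    have hy' : y.2 ∈ R.map Prod.snd := List.mem_map_of_mem hy
    rw [hRsnd, List.mem_append, List.mem_append, List.mem_append] at hy'
    rcases hy' with hy' | hy' | hy' | hy'
    · rw [List.eq_of_mem_replicate hy']
    · rw [List.eq_of_mem_replicate hy']
    · rw [List.eq_of_mem_replicate hy']; exact hmspec.1
    · obtain ⟨z, hz, hzy⟩ := List.mem_map.1 hy'
      rw [← hzy]
      exact h.pos z hz
  -- the parts before the non-overlined even parts, apart from the bad ones
  have hOle := hc.O_le T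
  have hmle : ∀ r, 1 ≤ r → c.keptO r T = if m ≤ r then c.O T else 0 := by
    intro r hr
    have h1 := leastUnused_le_iff M r
    rw [← hm, hMlast r hr] at h1
    rw [keptO]
    split_ifs with h2
    · have := h1.1 h2
      omega
    · have := fun h3 => h2 (h1.2 h3)
      omega
  have hM'nd : M'.Nodup := by
    rcases (show c.O T = 0 ∨ c.O T = 1 by omega) with h0 | h0
    · rw [hM', h0]; exact hMnd
    · rw [hM', h0]; exact List.nodup_cons.2 ⟨hmspec.2, hMnd⟩
  have hM'pos : ∀ a ∈ M', 1 ≤ a := by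
    intro a ha
    rw [hM', List.mem_append] at ha
    rcases ha with ha | ha
    · rw [List.eq_of_mem_replicate ha]; exact hmspec.1
    · exact hMpos a ha
  have hM'used : ∀ r, 1 ≤ r → usedUpTo r M' = c.e T + c.keptE r T + c.keptO r T := by
    intro r hr
    rw [usedUpTo_eq_countP hM'nd hM'pos, hM', List.countP_append, ← usedUpTo_eq_countP hMnd hMpos,
      hMlast r hr, hmle r hr, List.countP_replicate]
    simp only [decide_eq_true_eq]
    omega
  -- the marks of the non-overlined even parts
  obtain ⟨B, hB1, hBused, hBmark⟩ : ∃ B : List ℕ, (0 < c.e (T + 1) → 1 ∈ B) ∧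
      (∀ r, 1 ≤ r → r - usedUpTo r B = min (r - c.e (T + 1))
        (r - max (c.e T + c.keptE r T + c.keptO r T) (min 1 (c.P T)))) ∧
      ∀ j, nextMark lam ((addMarks B j).map (fun a => (pl (2 * T + 2), a)) ++ R)
        (pl (2 * T + 2)) = leastUnused (addMarks B j ++ B) := by
    have hele := hc.e_le (T + 1)
    have hDmem : ∀ a, a ∈ D ↔ (0 < c.e (T + 1) ∨ 0 < c.P T) ∧ a = 1 ∨ a ∈ M' := by
      intro a
      rw [hD, ← hM']
      simp only [List.mem_append, List.mem_replicate]
      constructor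
      · rintro (⟨h1, h2⟩ | ⟨h1, h2⟩ | h1)
        · exact Or.inl ⟨Or.inl (by omega), h2⟩
        · exact Or.inl ⟨Or.inr (by omega), h2⟩
        · exact Or.inr h1
      · rintro (⟨h1 | h1, h2⟩ | h1)
        · exact Or.inl ⟨by omega, h2⟩
        · exact Or.inr (Or.inl ⟨by omega, h2⟩)
        · exact Or.inr (Or.inr h1)
    by_cases hex : (2 ≤ leastUsed M ∧ (0 < c.P T ∨ 0 < c.e (T + 1)) ∧ c.O T = 0)
    · obtain ⟨hg2, hbad, hO0⟩ := hex
      have hne : M ≠ [] := by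
        rintro rfl
        have : leastUsed [] = 0 := rfl
        omega
      have h1M : 1 ∉ M := fun h1 => by
        have := (leastUsed_spec hne).2 1 h1
        omega
      have hM'M : M' = M := by rw [hM', hO0]; rfl
      refine ⟨1 :: M.erase (leastUsed M), fun _ => List.mem_cons_self, fun r hr => ?_, fun j => ?_⟩
      · rw [usedUpTo_exceptional hMnd hMpos hne h1M hr, ← hM'M, hM'used r hr]
        omega
      · rw [nextMark_pl_even hRsize hRM hRD]
        simp only [hpl, hov', hov, hO0, lt_irrefl, not_false_eq_true, and_true]
        refine exceptional_mark hMnd hbad rfl hg2 hne (fun a => ?_) ?_ j rfl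
        · rw [hDmem, hM'M]
          have : 0 < c.e (T + 1) ∨ 0 < c.P T := hbad.symm
          tauto
        · rw [hR]
          rcases Nat.eq_zero_or_pos (c.e (T + 1)) with h0 | h0
          · obtain ⟨n, hn⟩ : ∃ n, c.P T = n + 1 := ⟨c.P T - 1, by omega⟩
            rw [h0, hn]; rfl
          · obtain ⟨n, hn⟩ : ∃ n, c.e (T + 1) = n + 1 := ⟨c.e (T + 1) - 1, by omega⟩
            rw [hn]; rfl
    · refine ⟨D, fun he => (hDmem 1).2 (Or.inl ⟨Or.inl he, rfl⟩), fun r hr => ?_, fun j => ?_⟩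
      · have hu := hM'used r hr
        by_cases hbad : 0 < c.e (T + 1) ∨ 0 < c.P T
        · by_cases h1 : 1 ∈ M'
          · have h2 : usedUpTo r D = usedUpTo r M' := by
              refine usedUpTo_congr r fun a => ?_
              rw [hDmem]
              constructor
              · rintro (⟨-, rfl⟩ | h3)
                · exact h1
                · exact h3
              · exact Or.inr
            have h3 : 0 < usedUpTo r M' := Finset.card_pos.2
              ⟨1, Finset.mem_filter.2 ⟨Finset.mem_Icc.2 ⟨le_rfl, hr⟩, h1⟩⟩
            omega
          · have hMnil : M = [] := by
              by_contra hne
              have hO0 : c.O T = 0 := by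
                by_contra hO0
                -- the overlined odd part would carry the mark `1`
                have hm1 : m = 1 := by
                  have h1M : 1 ∉ M := fun h3 => h1 (by rw [hM']; exact List.mem_append_right _ h3)
                  rw [hm, leastUnused_eq_iff]
                  exact ⟨⟨le_rfl, h1M⟩, by omega⟩
                exact h1 (by
                  rw [hM', hm1]
                  exact List.mem_append_left _ (List.mem_replicate.2 ⟨hO0, rfl⟩))
              have hlu := (leastUsed_spec hne).1
              have := hMpos _ hlu
              have : leastUsed M ≠ 1 := fun h3 => h1 (by
                rw [hM', ← h3]; exact List.mem_append_right _ hlu)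
              exact hex ⟨by omega, hbad.symm, hO0⟩
            have hO0 : c.O T = 0 := by
              by_contra hO0
              have hm1 : m = 1 := by rw [hm, hMnil, leastUnused_nil]
              exact h1 (by
                rw [hM', hm1]
                exact List.mem_append_left _ (List.mem_replicate.2 ⟨hO0, rfl⟩))
            have hM'nil : M' = [] := by rw [hM', hO0, hMnil]; rfl
            have h2 : usedUpTo r D = 1 := by
              rw [usedUpTo, Finset.card_eq_one]
              refine ⟨1, ?_⟩
              ext a
              rw [Finset.mem_filter, hDmem, hM'nil, Finset.mem_singleton, Finset.mem_Icc]
              constructor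
              · rintro ⟨-, ⟨-, h3⟩ | h3⟩
                · exact h3
                · exact absurd h3 List.not_mem_nil
              · rintro rfl
                exact ⟨⟨le_rfl, hr⟩, Or.inl ⟨hbad, rfl⟩⟩
            have h3 : usedUpTo r M' = 0 := by rw [hM'nil]; simp [usedUpTo]
            omega
        · have h2 : usedUpTo r D = usedUpTo r M' := by
            refine usedUpTo_congr r fun a => ?_
            rw [hDmem]
            tauto
          omega
      · rw [nextMark_pl_even hRsize hRM hRD, if_neg]
        rintro ⟨h1, -, h2, h3⟩
        rw [hpl, hov'] at h2
        rw [hov] at h3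
        exact hex ⟨h1, h2, by omega⟩
  have hfold : (c.block T).foldl (markStep lam) prev =
      (addMarks B (c.E (T + 1))).map (fun a => (pl (2 * T + 2), a)) ++ R := by
    rw [block, List.foldl_append, List.foldl_append, List.foldl_append, hO,
      foldl_markStep_of_one (fun p => nextMark_pl_odd lam p T),
      foldl_markStep_of_one (fun p => nextMark_ov_even lam p T), ← hR,
      foldl_markStep_of_addMarks hBmark]
  obtain ⟨hAnd, hApos, hAB⟩ := addMarks_spec B (c.E (T + 1))
  have hnew : ∀ y ∈ (addMarks B (c.E (T + 1))).map (fun a => (pl (2 * T + 2), a)),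
      y.1.size = 2 * T + 2 ∧ 1 ≤ y.2 := by
    intro y hy
    obtain ⟨a, ha, rfl⟩ := List.mem_map.1 hy
    exact ⟨rfl, hApos a ha⟩
  have htop : marksWhere ((addMarks B (c.E (T + 1))).map (fun a => (pl (2 * T + 2), a)) ++ R)
      (fun y => y.size = 2 * (T + 1)) =
      addMarks B (c.E (T + 1)) ++ List.replicate (c.e (T + 1)) 1 := by
    rw [marksWhere_append, marksWhere_of_forall, List.map_map, ← hRtop]
    · congr 1
      exact List.map_id _
    · intro y hy
      exact (hnew y hy).1
  have hele := hc.e_le (T + 1)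
  have htopnd : (addMarks B (c.E (T + 1)) ++ List.replicate (c.e (T + 1)) 1).Nodup := by
    rw [List.nodup_append]
    refine ⟨hAnd, ?_, fun a ha b hb hab => ?_⟩
    · rw [List.nodup_replicate]; exact hele
    · rw [List.mem_replicate] at hb
      refine hAB a ha ?_
      rw [hab, hb.2]
      exact hB1 (by omega)
  have hAcount : ∀ r, 1 ≤ r → (addMarks B (c.E (T + 1))).countP (· ≤ r) = c.keptE r (T + 1) := by
    intro r hr
    rw [countP_addMarks, hBused r hr, keptE_succ]
  have hone : ∀ n r, 1 ≤ r → (List.replicate n 1).countP (· ≤ r) = n := by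
    intro n r hr
    rw [List.countP_replicate, if_pos (by simpa using hr)]
  rw [hfold]
  refine ⟨?_, ?_, ?_, fun r hr => ?_, fun r hr => ?_⟩
  · intro y hy
    rw [List.mem_append] at hy
    rcases hy with hy | hy
    · rw [(hnew y hy).1]; omega
    · exact hRsize y hy
  · intro y hy
    rw [List.mem_append] at hy
    rcases hy with hy | hy
    · exact (hnew y hy).2
    · exact hRpos y hy
  · rw [htop]; exact htopnd
  · rw [htop, usedUpTo_eq_countP htopnd, List.countP_append, hAcount r hr, hone _ r hr]
    · omega
    · intro a ha
      rw [List.mem_append, List.mem_replicate] at ha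
      rcases ha with ha | ha
      · exact hApos a ha
      · omega
  · have h1 : ((addMarks B (c.E (T + 1))).map (fun a => (pl (2 * T + 2), a))).map Prod.snd =
        addMarks B (c.E (T + 1)) := by
      rw [List.map_map]; exact List.map_id _
    have h2 : (List.replicate (c.O T) m).countP (· ≤ r) = c.keptO r T := by
      rw [hmle r hr, List.countP_replicate]
      simp only [decide_eq_true_eq]
    rw [List.map_append, h1, hRsnd, List.countP_append, List.countP_append, List.countP_append,
      List.countP_append, hAcount r hr, hone _ r hr, hone _ r hr, h2, h.count r hr, kept_succ]
    omega

end Conf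

/-! ### Overpartitions and frequencies -/

/-- The frequencies of the parts of an overpartition. -/
def Overpartition.conf (lam : Overpartition) : Conf where
  E t := lam.freq (pl (2 * t))
  e t := lam.freq (ov (2 * t))
  O t := lam.freq (ov (2 * t + 1))
  P t := lam.freq (pl (2 * t + 1))

theorem rank_ov (a : ℕ) : (ov a).rank = 2 * a := rfl

theorem rank_pl (a : ℕ) : (pl a).rank = 2 * a + 1 := rfl

theorem OPart.exists_eq (x : OPart) :
    ∃ t, x = pl (2 * t) ∨ x = ov (2 * t) ∨ x = ov (2 * t + 1) ∨ x = pl (2 * t + 1) := by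
  obtain ⟨s, b⟩ := x
  obtain ⟨t, ht | ht⟩ := Nat.even_or_odd' s <;> cases b <;> exact ⟨t, by simp [pl, ov, ht]⟩

theorem Overpartition.proper_conf (lam : Overpartition) : lam.conf.Proper where
  E_zero := List.count_eq_zero.2 fun h => absurd (lam.pos _ h) (by simp [pl])
  e_zero := List.count_eq_zero.2 fun h => absurd (lam.pos _ h) (by simp [ov])
  e_le t := lam.count_overlined_le_one _
  O_le t := lam.count_overlined_le_one _
  below := by
    refine ⟨lam.size + 1, fun t ht => ?_⟩
    have h : ∀ x : OPart, lam.size < x.size → lam.freq x = 0 := by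
      intro x hx
      refine List.count_eq_zero.2 fun hmem => ?_
      have : x.size ≤ lam.size := List.single_le_sum (by simp) _ (List.mem_map_of_mem hmem)
      omega
    refine ⟨h _ ?_, h _ ?_, h _ ?_, h _ ?_⟩ <;> simp only [pl, ov] <;> omega

namespace Conf

theorem count_block (c : Conf) (t : ℕ) (x : OPart) : (c.block t).count x =
    (if ov (2 * t + 1) = x then c.O t else 0) + ((if pl (2 * t + 1) = x then c.P t else 0) +
      ((if ov (2 * t + 2) = x then c.e (t + 1) else 0) +
        if pl (2 * t + 2) = x then c.E (t + 1) else 0)) := by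
  simp only [block, List.count_append, List.count_replicate, beq_iff_eq]

theorem count_toList (c : Conf) (t T : ℕ) :
    (c.toList T).count (pl (2 * t)) = (if 1 ≤ t ∧ t ≤ T then c.E t else 0) ∧
    (c.toList T).count (ov (2 * t)) = (if 1 ≤ t ∧ t ≤ T then c.e t else 0) ∧
    (c.toList T).count (ov (2 * t + 1)) = (if t < T then c.O t else 0) ∧
    (c.toList T).count (pl (2 * t + 1)) = (if t < T then c.P t else 0) := by
  induction T with
  | zero => simp [toList]; omega
  | succ T ih =>
    obtain ⟨h1, h2, h3, h4⟩ := ih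
    simp only [toList, List.count_append, h1, h2, h3, h4, count_block]
    simp only [pl, ov, OPart.mk.injEq, Bool.true_eq_false, Bool.false_eq_true, and_true, and_false,
      if_false, zero_add, add_zero]
    by_cases ht : t = T + 1
    · subst ht
      refine ⟨?_, ?_, ?_, ?_⟩ <;> split_ifs <;> omega
    · by_cases ht' : t = T
      · subst ht'
        refine ⟨?_, ?_, ?_, ?_⟩ <;> split_ifs <;> omega
      · refine ⟨?_, ?_, ?_, ?_⟩ <;> split_ifs <;> omega

theorem size_of_mem_block {c : Conf} {t : ℕ} {x : OPart} (hx : x ∈ c.block t) :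
    2 * t + 1 ≤ x.size ∧ x.size ≤ 2 * t + 2 := by
  simp only [block, List.mem_append] at hx
  rcases hx with hx | hx | hx | hx <;> rw [List.eq_of_mem_replicate hx] <;>
    simp only [ov, pl] <;> omega

theorem size_of_mem_toList {c : Conf} {T : ℕ} {x : OPart} (hx : x ∈ c.toList T) :
    1 ≤ x.size ∧ x.size ≤ 2 * T := by
  induction T with
  | zero => simp [toList] at hx
  | succ T ih =>
    rw [toList, List.mem_append] at hx
    rcases hx with hx | hx
    · have := ih hx; omega
    · have := size_of_mem_block hx; omega

theorem pairwise_toList (c : Conf) (T : ℕ) :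
    (c.toList T).Pairwise (fun x y => x.rank ≤ y.rank) := by
  induction T with
  | zero => exact List.Pairwise.nil
  | succ T ih =>
    rw [toList, List.pairwise_append]
    refine ⟨ih, ?_, fun x hx y hy => ?_⟩
    · simp only [block, List.pairwise_append, List.pairwise_replicate, List.mem_append,
        List.mem_replicate]
      refine ⟨Or.inr le_rfl, ⟨Or.inr le_rfl, ⟨Or.inr le_rfl, Or.inr le_rfl, ?_⟩, ?_⟩, ?_⟩
      · rintro _ ⟨-, rfl⟩ _ ⟨-, rfl⟩
        simp [OPart.rank, ov, pl]
      · rintro _ ⟨-, rfl⟩ _ (⟨-, rfl⟩ | ⟨-, rfl⟩) <;> simp [OPart.rank, ov, pl]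
      · rintro _ ⟨-, rfl⟩ _ (⟨-, rfl⟩ | ⟨-, rfl⟩ | ⟨-, rfl⟩) <;>
          simp only [rank_ov, rank_pl] <;> omega
    · have h1 := size_of_mem_toList hx
      have h2 := size_of_mem_block hy
      simp only [OPart.rank]
      split_ifs <;> omega

theorem sum_toList {c : Conf} (T : ℕ) : ((c.toList T).map OPart.size).sum =
    c.weight T + 2 * T * (c.E T + c.e T) := by
  induction T with
  | zero => simp [toList, weight]
  | succ T ih =>
    have h : c.weight (T + 1) = c.weight T +
        (2 * T * (c.E T + c.e T) + (2 * T + 1) * (c.O T + c.P T)) :=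
      Finset.sum_range_succ _ _
    rw [toList, List.map_append, List.sum_append, ih, h]
    simp only [block, List.map_append, List.map_replicate, List.sum_append, List.sum_replicate,
      smul_eq_mul, ov, pl]
    ring

end Conf

theorem OPart.rank_injective : Function.Injective OPart.rank := by
  rintro ⟨s, b⟩ ⟨s', b'⟩ h
  cases b <;> cases b' <;> simp [OPart.rank] at h ⊢ <;> omega

namespace Overpartition

theorem parts_eq (lam : Overpartition) {K : ℕ} (hK : lam.conf.Below K) :
    lam.parts = lam.conf.toList K := by
  have hc := lam.proper_conf
  refine List.Perm.eq_of_pairwise (le := fun x y => x.rank ≤ y.rank)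
    (fun x y _ _ h1 h2 => OPart.rank_injective (le_antisymm h1 h2)) lam.sorted
    (lam.conf.pairwise_toList K) (List.perm_iff_count.2 fun x => ?_)
  obtain ⟨t, ht⟩ := x.exists_eq
  obtain ⟨h1, h2, h3, h4⟩ := lam.conf.count_toList t K
  have h5 := hK t
  have h6 := hc.E_zero
  have h7 := hc.e_zero
  rcases ht with rfl | rfl | rfl | rfl
  · rw [h1]
    change lam.conf.E t = _
    rcases t with _ | t
    · simp [h6]
    · split_ifs <;> omega
  · rw [h2]
    change lam.conf.e t = _
    rcases t with _ | t
    · simp [h7]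
    · split_ifs <;> omega
  · rw [h3]
    change lam.conf.O t = _
    split_ifs <;> omega
  · rw [h4]
    change lam.conf.P t = _
    split_ifs <;> omega

theorem conf_injective : Function.Injective conf := by
  intro a b h
  obtain ⟨K, hK⟩ := a.proper_conf.below
  refine Overpartition.ext ?_
  rw [a.parts_eq hK, b.parts_eq (h ▸ hK), h]

theorem exists_conf_eq {c : Conf} (hc : c.Proper) : ∃ lam : Overpartition, lam.conf = c := by
  obtain ⟨K, hK⟩ := hc.below
  have hcount := fun t => c.count_toList t K
  refine ⟨⟨c.toList K, fun x hx => (Conf.size_of_mem_toList hx).1, c.pairwise_toList K,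
    fun a => ?_⟩, ?_⟩
  · obtain ⟨t, rfl | rfl⟩ := Nat.even_or_odd' a
    · rw [(hcount t).2.1]
      have := hc.e_le t
      split_ifs <;> omega
    · rw [(hcount t).2.2.1]
      have := hc.O_le t
      split_ifs <;> omega
  · have h6 := hc.E_zero
    have h7 := hc.e_zero
    ext t
    · refine (hcount t).1.trans ?_
      have := hK t
      rcases t with _ | t
      · simp [h6]
      · split_ifs <;> omega
    · refine (hcount t).2.1.trans ?_
      have := hK t
      rcases t with _ | t
      · simp [h7]
      · split_ifs <;> omega
    · refine (hcount t).2.2.1.trans ?_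
      have := hK t
      split_ifs <;> omega
    · refine (hcount t).2.2.2.trans ?_
      have := hK t
      split_ifs <;> omega

theorem size_eq_weight (lam : Overpartition) {K : ℕ} (hK : lam.conf.Below K) :
    lam.size = lam.conf.weight K := by
  have h := hK K le_rfl
  rw [size, lam.parts_eq hK, Conf.sum_toList, h.1, h.2.1]
  rfl

theorem freq_pos (lam : Overpartition) (x : OPart) : 0 < lam.freq x ↔ x ∈ lam.parts :=
  List.count_pos_iff

theorem markInv (lam : Overpartition) (T : ℕ) :
    lam.conf.MarkInv T ((lam.conf.toList T).foldl (markStep lam.parts) []) := by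
  induction T with
  | zero =>
    exact ⟨by simp [Conf.toList], by simp [Conf.toList], by simp [Conf.toList, marksWhere],
      fun r _ => by simp [Conf.toList, marksWhere, usedUpTo, lam.proper_conf.e_zero,
        Conf.keptE_zero],
      fun r _ => by simp [Conf.toList, lam.proper_conf.e_zero, Conf.keptE_zero, Conf.kept]⟩
  | succ T ih =>
    rw [Conf.toList, List.foldl_append]
    exact ih.succ lam.proper_conf (lam.freq_pos _).symm (lam.freq_pos _).symm
      (lam.freq_pos _).symm

/-- The greedy scan of capacity `r` keeps as many parts as have marks up to `r`. -/
theorem kept_eq_sum_numMarked (lam : Overpartition) {K : ℕ} (hK : lam.conf.Below K) {r : ℕ}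
    (hr : 1 ≤ r) : lam.conf.kept r K = ∑ s ∈ Finset.Icc 1 r, lam.numMarked s := by
  have hmark : lam.marking = (lam.conf.toList K).foldl (markStep lam.parts) [] := by
    rw [← lam.parts_eq hK]; rfl
  have hinv := lam.markInv K
  rw [← hmark] at hinv
  have h1 := hinv.count r hr
  have h2 := hK K le_rfl
  have h3 := lam.conf.keptE_le r K
  have hpos : ∀ a ∈ lam.marking.map Prod.snd, 1 ≤ a := by
    intro a ha
    obtain ⟨y, hy, rfl⟩ := List.mem_map.1 ha
    exact hinv.pos y hy
  have hsum : ∀ (l : List ℕ), (∀ a ∈ l, 1 ≤ a) →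
      l.countP (· ≤ r) = ∑ s ∈ Finset.Icc 1 r, l.count s := by
    intro l hl
    induction l with
    | nil => simp
    | cons a l ih =>
      have ha := hl a List.mem_cons_self
      simp only [List.countP_cons, List.count_cons, Finset.sum_add_distrib, beq_iff_eq,
        decide_eq_true_eq]
      rw [ih fun b hb => hl b (List.mem_cons_of_mem _ hb), Finset.sum_ite_eq]
      simp [ha]
  have h4 := hsum _ hpos
  change _ = ∑ s ∈ Finset.Icc 1 r, (lam.marking.map Prod.snd).count s
  omega

theorem head_iff (lam : Overpartition) : (∀ x ∈ lam.parts.head?, x.OddOvOrEvenPl) ↔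
    (∀ t, 0 < lam.conf.P t → ∃ s, s ≤ t ∧ 0 < lam.conf.O s + lam.conf.E s) ∧
      ∀ t, 0 < lam.conf.e t → ∃ s, s < t ∧ 0 < lam.conf.O s + lam.conf.E s := by
  have hsorted := lam.sorted
  have key : ∀ x y, x ∈ lam.parts.head? → y ∈ lam.parts → x.rank ≤ y.rank := by
    intro x y hx hy
    rcases hl : lam.parts with _ | ⟨a, l⟩
    · rw [hl] at hy; simp at hy
    · rw [hl] at hx hy hsorted
      obtain rfl : a = x := by simpa using hx
      rcases List.mem_cons.1 hy with rfl | hy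
      · exact le_rfl
      · exact List.rel_of_pairwise_cons hsorted hy
  have hex : ∀ y ∈ lam.parts, ∃ x, x ∈ lam.parts.head? ∧ x ∈ lam.parts := by
    intro y hy
    rcases hl : lam.parts with _ | ⟨a, l⟩
    · rw [hl] at hy; simp at hy
    · exact ⟨a, by simp, by simp⟩
  constructor
  · intro h
    have hgood : ∀ y ∈ lam.parts, ∃ s, 0 < lam.conf.O s + lam.conf.E s ∧ 4 * s + 1 ≤ y.rank ∧
        (0 < lam.conf.E s ∨ 4 * s + 2 ≤ y.rank) := by
      intro y hy
      obtain ⟨x, hx, hxm⟩ := hex y hy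
      have hr := key x y hx hy
      have hx' := h x hx
      obtain ⟨s, rfl | rfl | rfl | rfl⟩ := x.exists_eq
      · have h1 : 0 < lam.conf.E s := (lam.freq_pos _).2 hxm
        rw [rank_pl] at hr
        exact ⟨s, by omega, by omega, Or.inl h1⟩
      · obtain ⟨⟨u, hu⟩, -⟩ | ⟨-, h0⟩ := hx'
        · simp only [ov] at hu
          omega
        · cases h0
      · have h1 : 0 < lam.conf.O s := (lam.freq_pos _).2 hxm
        rw [rank_ov] at hr
        exact ⟨s, by omega, by omega, Or.inr (by omega)⟩
      · obtain ⟨-, h0⟩ | ⟨⟨u, hu⟩, -⟩ := hx'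
        · cases h0
        · simp only [pl] at hu
          omega
    refine ⟨fun t ht => ?_, fun t ht => ?_⟩
    · obtain ⟨s, h1, h2, -⟩ := hgood _ ((lam.freq_pos _).1 ht)
      rw [rank_pl] at h2
      exact ⟨s, by omega, h1⟩
    · obtain ⟨s, h1, h2, -⟩ := hgood _ ((lam.freq_pos _).1 ht)
      rw [rank_ov] at h2
      exact ⟨s, by omega, h1⟩
  · rintro ⟨hP, he⟩ x hx
    have hxm : x ∈ lam.parts := List.mem_of_mem_head? hx
    have hgood : ∀ s, 0 < lam.conf.O s + lam.conf.E s → x.rank ≤ 4 * s + 2 := by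
      intro s hs
      rcases (show 0 < lam.conf.O s ∨ 0 < lam.conf.E s by omega) with h1 | h1
      · have := key _ _ hx ((lam.freq_pos _).1 h1)
        rw [rank_ov] at this
        omega
      · have := key _ _ hx ((lam.freq_pos _).1 h1)
        rw [rank_pl] at this
        omega
    obtain ⟨t, rfl | rfl | rfl | rfl⟩ := x.exists_eq
    · exact Or.inr ⟨⟨t, by simp [pl]; omega⟩, rfl⟩
    · obtain ⟨s, hs, hs'⟩ := he t ((lam.freq_pos _).2 hxm)
      have := hgood s hs'
      rw [rank_ov] at this
      omega
    · exact Or.inl ⟨⟨t, by simp [ov]⟩, rfl⟩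
    · obtain ⟨s, hs, hs'⟩ := hP t ((lam.freq_pos _).2 hxm)
      have := hgood s hs'
      rw [rank_pl] at this
      omega

end Overpartition

theorem mem_setF_iff {k i : ℕ} {N : ℕ → ℕ} {lam : Overpartition} :
    lam ∈ setF k i N ↔ lam.conf.InF k i N := by
  constructor
  · rintro ⟨⟨h1, h2, h3⟩, h4, h5⟩
    obtain ⟨h6, h7⟩ := lam.head_iff.1 h4
    refine ⟨lam.proper_conf, h1, h2, h3, h6, h7, fun K hK r hr hrk => ?_⟩
    rw [lam.kept_eq_sum_numMarked hK hr]
    refine Finset.sum_congr rfl fun s hs => ?_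
    rw [Finset.mem_Icc] at hs
    exact h5 s hs.1 (by omega)
  · intro h
    refine ⟨⟨h.first, h.cap, h.cap_of_P⟩, lam.head_iff.2 ⟨h.small_P, h.small_e⟩, fun r hr hrk => ?_⟩
    obtain ⟨K, hK⟩ := lam.proper_conf.below
    have hsum : ∀ r, 1 ≤ r → r < k →
        ∑ s ∈ Finset.Icc 1 r, lam.numMarked s = ∑ s ∈ Finset.Icc 1 r, N s := fun r hr hrk => by
      rw [← lam.kept_eq_sum_numMarked hK hr, h.kept_eq K hK r hr hrk]
    have h1 := hsum r hr hrk
    obtain ⟨r, rfl⟩ : ∃ s, r = s + 1 := ⟨r - 1, by omega⟩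
    rw [Finset.sum_Icc_succ_top (by omega), Finset.sum_Icc_succ_top (by omega)] at h1
    rcases Nat.eq_zero_or_pos r with rfl | hr'
    · simpa using h1
    · have h2 := hsum r hr' (by omega)
      omega

theorem mem_setG_iff {k i : ℕ} {N : ℕ → ℕ} {lam : Overpartition} :
    lam ∈ setG k i N ↔ lam.conf.InF k i N ∧ ∀ t, lam.conf.e t = 0 ∧ lam.conf.P t = 0 := by
  rw [setG, Set.mem_ofPred_eq, mem_setF_iff]
  refine and_congr_right fun _ => ⟨fun h t => ?_, fun h => ⟨?_, ?_⟩⟩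
  · refine ⟨List.count_eq_zero.2 fun hm => h.1 _ hm ⟨⟨t, by simp [ov]; omega⟩, rfl⟩,
      List.count_eq_zero.2 fun hm => h.2 _ hm ⟨⟨t, rfl⟩, rfl⟩⟩
  · rintro ⟨s, b⟩ hx ⟨⟨t, ht⟩, hb⟩
    simp only at ht hb
    subst ht hb
    have := (lam.freq_pos _).2 hx
    have h0 : lam.freq (ov (2 * t)) = 0 := (h t).1
    rw [ov, two_mul] at h0
    omega
  · rintro ⟨s, b⟩ hx ⟨⟨t, ht⟩, hb⟩
    simp only at ht hb
    subst ht hb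
    have := (lam.freq_pos _).2 hx
    have h0 : lam.freq (pl (2 * t + 1)) = 0 := (h t).2
    rw [pl] at h0
    omega

/-! ### Making the bad parts good one after the other -/

/-- The members of `setF k i N` whose bad parts are all among the first `m` parts with mark `1`. -/
def setS (k i : ℕ) (N : ℕ → ℕ) (m : ℕ) : Set Overpartition :=
  {lam | lam.conf.InF k i N ∧ lam.conf.BadLE m}

variable {k i m : ℕ} {N : ℕ → ℕ}

theorem setS_subset_succ : setS k i N m ⊆ setS k i N (m + 1) := fun _ h =>
  ⟨h.1, fun t ht => (h.2.1 t ht).trans (Nat.le_succ m),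
    fun t ht => (h.2.2 t ht).trans (Nat.le_succ m)⟩

theorem setS_total (hk : 2 ≤ k) : setS k i N (N 1) = setF k i N := by
  ext lam
  rw [mem_setF_iff]
  exact ⟨fun h => h.1, fun h => ⟨h, h.badLE_total hk⟩⟩

theorem setS_one : setS k i N 1 = setG k i N := by
  ext lam
  rw [mem_setG_iff]
  refine ⟨fun h => ⟨h.1, h.1.bad_eq_zero h.2⟩, fun h => ⟨h.1, fun t ht => ?_, fun t ht => ?_⟩⟩
  · have := (h.2 t).2
    omega
  · have := (h.2 t).1
    omega

theorem setF_eq_setG_of_k_le_one (hk : k ≤ 1) : setF k i N = setG k i N := by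
  ext lam
  rw [mem_setF_iff, mem_setG_iff]
  refine ⟨fun h => ⟨h, fun t => ?_⟩, fun h => h.1⟩
  have h1 := h.cap t
  have h2 := h.cap_of_P t
  omega

theorem setF_eq_setG_of_zero (hk : 2 ≤ k) (hN : N 1 = 0) : setF k i N = setG k i N := by
  refine Set.Subset.antisymm ?_ fun lam h => h.1
  rw [← setS_total hk, ← setS_one, hN]
  exact setS_subset_succ

/-- Making the bad part at the position `m + 1` good. -/
theorem exists_equiv_diff (hk : 2 ≤ k) (hm : 1 ≤ m) (hmN : m < N 1) :
    ∃ Ψ : (setS k i N (m + 1) \ setS k i N m : Set Overpartition) ≃ setS k i N m,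
      ∀ x, (Ψ x).1.size = x.1.size + 2 * (N 1 - m) := by
  let R (lam mu : Overpartition) : Prop := ∃ t₀ gE gO aE aO,
    Conf.Shift t₀ gE gO aE aO lam.conf mu.conf ∧
      ∀ K, lam.conf.Below K → Conf.moved aE aO K + m = N 1
  have hfwd : ∀ lam : (setS k i N (m + 1) \ setS k i N m : Set Overpartition),
      ∃ mu : setS k i N m, R lam.1 mu.1 := by
    rintro ⟨lam, ⟨h1, h2⟩, h3⟩
    obtain ⟨t₀, gE, gO, aE, aO, c', h, hF, hle, hmoved⟩ :=
      Conf.exists_image h1 hk h2 fun h4 => h3 ⟨h1, h4⟩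
    obtain ⟨mu, rfl⟩ := Overpartition.exists_conf_eq hF.toProper
    exact ⟨⟨mu, hF, hle⟩, t₀, gE, gO, aE, aO, h, hmoved⟩
  choose f hf using hfwd
  have hbij : Function.Bijective f := by
    constructor
    · intro x y hxy
      obtain ⟨t₀, gE, gO, aE, aO, h1, h2⟩ := hf x
      obtain ⟨t₁, gE', gO', aE', aO', h3, h4⟩ := hf y
      rw [hxy] at h1
      obtain ⟨K, hK⟩ := (f y).1.proper_conf.below
      have h5 := h2 K (h1.below_left hK)
      have h6 := h4 K (h3.below_left hK)
      exact Subtype.ext (Overpartition.conf_injective (h1.left_unique h3 hK (by omega)))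
    · rintro ⟨mu, h1, h2⟩
      obtain ⟨t₀, gE, gO, aE, aO, c, h, hF, hle, hnot, hmoved⟩ :=
        Conf.exists_preimage h1 hk hm hmN h2
      obtain ⟨lam, rfl⟩ := Overpartition.exists_conf_eq hF.toProper
      refine ⟨⟨lam, ⟨hF, hle⟩, fun h3 => hnot h3.2⟩, ?_⟩
      obtain ⟨t₁, gE', gO', aE', aO', h3, -⟩ := hf ⟨lam, ⟨hF, hle⟩, fun h3 => hnot h3.2⟩
      exact Subtype.ext (Overpartition.conf_injective (h3.right_unique h))
  refine ⟨Equiv.ofBijective f hbij, fun x => ?_⟩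
  obtain ⟨t₀, gE, gO, aE, aO, h1, h2⟩ := hf x
  obtain ⟨K, hK⟩ := x.1.proper_conf.below
  have h3 := h1.weight_eq hK
  have h4 := h2 K hK
  have h5 := (f x).1.size_eq_weight (h1.below_right hK)
  have h6 := x.1.size_eq_weight hK
  rw [Equiv.ofBijective_apply]
  omega

/-! ### Collecting the negative even parts -/

theorem mem_setR_of_nonpos {M : ℤ} (hM : M ≤ 0) {τ : Finset ℤ} : τ ∈ setR M ↔ τ = ∅ := by
  refine ⟨fun h => Finset.eq_empty_of_forall_notMem fun x hx => ?_, ?_⟩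
  · have := h x hx
    omega
  · rintro rfl x hx
    exact absurd hx (Finset.notMem_empty x)

/-- A partition in `setR (j + 1)` contains the part `-2 (j + 1)` or not. -/
theorem exists_equiv_setR (j : ℕ) :
    ∃ f : setR (j : ℤ) ⊕ setR (j : ℤ) ≃ setR ((j + 1 : ℕ) : ℤ),
      (∀ τ, (f (Sum.inl τ)).1 = τ.1) ∧
        ∀ τ, ∑ x ∈ (f (Sum.inr τ)).1, x = ∑ x ∈ τ.1, x - 2 * ((j : ℤ) + 1) := by
  have hnot : ∀ τ : setR (j : ℤ), -2 * ((j : ℤ) + 1) ∉ τ.1 := fun τ h => by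
    have := τ.2 _ h
    omega
  let f : setR (j : ℤ) ⊕ setR (j : ℤ) → setR ((j + 1 : ℕ) : ℤ) := Sum.elim
    (fun τ => ⟨τ.1, fun x hx => by
      have := τ.2 x hx
      push_cast
      exact ⟨this.1, by omega, this.2.2⟩⟩)
    (fun τ => ⟨insert (-2 * ((j : ℤ) + 1)) τ.1, fun x hx => by
      push_cast
      rcases Finset.mem_insert.1 hx with rfl | hx
      · exact ⟨⟨-((j : ℤ) + 1), by ring⟩, by omega, by omega⟩
      · have := τ.2 x hx
        exact ⟨this.1, by omega, this.2.2⟩⟩)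
  have hbij : Function.Bijective f := by
    constructor
    · rintro (τ | τ) (τ' | τ') h
      · have h1 : (f (Sum.inl τ)).1 = (f (Sum.inl τ')).1 := by rw [h]
        exact congrArg Sum.inl (Subtype.ext h1)
      · have h1 : τ.1 = insert (-2 * ((j : ℤ) + 1)) τ'.1 := congrArg Subtype.val h
        exact absurd (h1 ▸ Finset.mem_insert_self _ _) (hnot τ)
      · have h1 : insert (-2 * ((j : ℤ) + 1)) τ.1 = τ'.1 := congrArg Subtype.val h
        exact absurd (h1 ▸ Finset.mem_insert_self _ _) (hnot τ')
      · have h1 : insert (-2 * ((j : ℤ) + 1)) τ.1 = insert (-2 * ((j : ℤ) + 1)) τ'.1 :=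
          congrArg Subtype.val h
        refine congrArg Sum.inr (Subtype.ext ?_)
        rw [← Finset.erase_insert (hnot τ), h1, Finset.erase_insert (hnot τ')]
    · rintro ⟨τ, hτ⟩
      have hmem : ∀ x ∈ τ, x ≠ -2 * ((j : ℤ) + 1) →
          Even x ∧ -2 * (j : ℤ) ≤ x ∧ x ≤ -2 := by
        intro x hx hne
        obtain ⟨⟨y, hy⟩, h2, h3⟩ := hτ x hx
        push_cast at h2
        exact ⟨⟨y, hy⟩, by omega, h3⟩
      by_cases h : -2 * ((j : ℤ) + 1) ∈ τ
      · refine ⟨Sum.inr ⟨τ.erase (-2 * ((j : ℤ) + 1)), fun x hx => ?_⟩,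
          Subtype.ext (Finset.insert_erase h)⟩
        rw [Finset.mem_erase] at hx
        exact hmem x hx.2 hx.1
      · exact ⟨Sum.inl ⟨τ, fun x hx => hmem x hx fun hx' => h (hx' ▸ hx)⟩, rfl⟩
  refine ⟨Equiv.ofBijective f hbij, fun τ => rfl, fun τ => ?_⟩
  change ∑ x ∈ insert (-2 * ((j : ℤ) + 1)) τ.1, x = _
  rw [Finset.sum_insert (hnot τ)]
  ring

/-- The bijection obtained from the steps that make the bad parts after position `m` good. -/
theorem exists_equiv_prod (hk : 2 ≤ k) (j m : ℕ) (hm : 1 ≤ m) (hjm : m + j = N 1) :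
    ∃ Φ : setR (j : ℤ) × setS k i N m ≃ setF k i N,
      ∀ p, ((Φ p).1.size : ℤ) = ∑ x ∈ p.1.1, x + (p.2.1.size : ℤ) := by
  classical
  induction j generalizing m with
  | zero =>
    have hu : ∀ τ : setR ((0 : ℕ) : ℤ), τ.1 = ∅ := fun τ =>
      (mem_setR_of_nonpos (by simp)).1 τ.2
    let u : Unique (setR ((0 : ℕ) : ℤ)) :=
      { default := ⟨∅, (mem_setR_of_nonpos (by simp)).2 rfl⟩
        uniq := fun τ => Subtype.ext (hu τ) }
    obtain rfl : m = N 1 := hjm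
    refine ⟨(Equiv.uniqueProd _ _).trans (Equiv.setCongr (setS_total hk)), fun p => ?_⟩
    rw [hu p.1, Finset.sum_empty, zero_add]
    rfl
  | succ j ih =>
    obtain ⟨Φ, hΦ⟩ := ih (m + 1) (by omega) (by omega)
    obtain ⟨Ψ, hΨ⟩ := exists_equiv_diff (i := i) (N := N) hk hm (by omega)
    obtain ⟨f, hf1, hf2⟩ := exists_equiv_setR j
    let S : setS k i N m ⊕ setS k i N m ≃ setS k i N (m + 1) :=
      (Equiv.sumCongr (Equiv.refl _) Ψ.symm).trans (Equiv.Set.sumDiffSubset setS_subset_succ)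
    let e : setR ((j + 1 : ℕ) : ℤ) × setS k i N m ≃ setF k i N :=
      (Equiv.prodCongr f.symm (Equiv.refl _)).trans
        ((Equiv.sumProdDistrib _ _ _).trans ((Equiv.prodSumDistrib _ _ _).symm.trans
          ((Equiv.prodCongr (Equiv.refl _) S).trans Φ)))
    refine ⟨e, ?_⟩
    rintro ⟨τ, mu⟩
    obtain ⟨τ | τ, rfl⟩ := f.surjective τ
    · have he : e (f (Sum.inl τ), mu) = Φ (τ, S (Sum.inl mu)) := by simp [e]
      rw [he, hΦ, hf1]
      rfl
    · have he : e (f (Sum.inr τ), mu) = Φ (τ, S (Sum.inr mu)) := by simp [e]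
      have hS : (S (Sum.inr mu)).1 = (Ψ.symm mu).1 := rfl
      have h1 := hΨ (Ψ.symm mu)
      rw [Equiv.apply_symm_apply] at h1
      rw [he, hΦ, hf2, hS]
      simp only
      omega

/-! ### Generating functions -/

theorem ncard_size_disjoint_union {A B : Set Overpartition} (h : Disjoint A B) (n : ℕ) :
    {lam ∈ A ∪ B | lam.size = n}.ncard =
      {lam ∈ A | lam.size = n}.ncard + {lam ∈ B | lam.size = n}.ncard := by
  rw [← Set.ncard_union_eq (h.mono (fun _ h => h.1) fun _ h => h.1)
    ((finite_size_eq n).subset fun _ h => h.2) ((finite_size_eq n).subset fun _ h => h.2)]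
  congr 1
  ext lam
  simp only [Set.mem_union, Set.mem_ofPred_eq]
  tauto

theorem genFun_union {A B : Set Overpartition} (h : Disjoint A B) :
    genFun (A ∪ B) = genFun A + genFun B := by
  rw [genFun, genFun, genFun, ← map_add]
  congr 1
  ext n
  rw [map_add, PowerSeries.coeff_mk, PowerSeries.coeff_mk, PowerSeries.coeff_mk,
    ncard_size_disjoint_union h]
  push_cast
  rfl

theorem qpow_add (a b : ℤ) : qpow (a + b) = qpow a * qpow b := by
  rw [qpow, qpow, qpow, HahnSeries.single_mul_single, one_mul]

theorem qpow_zero : qpow 0 = 1 := rfl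

theorem qpow_pow (a : ℤ) (j : ℕ) : qpow a ^ j = qpow (a * j) := by
  induction j with
  | zero => rw [pow_zero, Nat.cast_zero, mul_zero, qpow_zero]
  | succ j ih => rw [pow_succ, ih, ← qpow_add]; congr 1; push_cast; ring

/-- A bijection that increases the size by `d` multiplies the generating function by `q ^ d`. -/
theorem genFun_of_equiv {A B : Set Overpartition} {d : ℕ} (Ψ : A ≃ B)
    (h : ∀ x, (Ψ x).1.size = x.1.size + d) : genFun B = qpow d * genFun A := by
  rw [genFun, genFun, qpow, ← HahnSeries.ofPowerSeries_X_pow, ← map_mul]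
  congr 1
  ext n
  rw [PowerSeries.coeff_X_pow_mul', PowerSeries.coeff_mk]
  have hsymm : ∀ y : B, y.1.size = (Ψ.symm y).1.size + d := fun y => by
    rw [← h, Equiv.apply_symm_apply]
  split_ifs with hd
  · rw [PowerSeries.coeff_mk]
    congr 1
    symm
    refine Set.ncard_congr (fun x hx => (Ψ ⟨x, hx.1⟩).1) (fun x hx => ⟨(Ψ ⟨x, hx.1⟩).2, ?_⟩)
      (fun x y hx hy hxy => ?_) fun y hy => ?_
    · have h1 := h ⟨x, hx.1⟩
      have h2 := hx.2
      simp only at h1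
      omega
    · exact congrArg Subtype.val (Ψ.injective (Subtype.ext hxy))
    · refine ⟨(Ψ.symm ⟨y, hy.1⟩).1, ⟨(Ψ.symm ⟨y, hy.1⟩).2, ?_⟩, ?_⟩
      · have h1 := hsymm ⟨y, hy.1⟩
        have h2 := hy.2
        simp only at h1
        omega
      · simp
  · have hempty : {lam ∈ B | lam.size = n} = ∅ := by
      refine Set.eq_empty_of_forall_notMem fun y hy => ?_
      have h1 := hsymm ⟨y, hy.1⟩
      have h2 := hy.2
      simp only at h1
      omega
    rw [hempty, Set.ncard_empty, Nat.cast_zero]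

theorem genFun_setS_succ (hk : 2 ≤ k) (hm : 1 ≤ m) (hmN : m < N 1) :
    genFun (setS k i N (m + 1)) =
      (1 + qpow (-2 * ((N 1 : ℤ) - m))) * genFun (setS k i N m) := by
  obtain ⟨Ψ, hΨ⟩ := exists_equiv_diff (i := i) (N := N) hk hm hmN
  have h1 := genFun_of_equiv Ψ hΨ
  have h2 : genFun (setS k i N (m + 1) \ setS k i N m) =
      qpow (-2 * ((N 1 : ℤ) - m)) * genFun (setS k i N m) := by
    rw [h1, ← mul_assoc, ← qpow_add]
    have : (-2 * ((N 1 : ℤ) - m) + ((2 * (N 1 - m) : ℕ) : ℤ)) = 0 := by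
      push_cast [Nat.cast_sub hmN.le]
      ring
    rw [this, qpow_zero, one_mul]
  rw [add_mul, one_mul, ← h2, ← genFun_union disjoint_sdiff_self_right,
    Set.union_sdiff_cancel setS_subset_succ]

theorem genFun_setS (hk : 2 ≤ k) (j : ℕ) (hj : j + 1 ≤ N 1) :
    genFun (setS k i N (j + 1)) =
      qPoch (-qpow (2 - 2 * (N 1 : ℤ))) (qpow 2) j * genFun (setG k i N) := by
  induction j with
  | zero => rw [qPoch, Finset.prod_range_zero, one_mul, zero_add, setS_one]
  | succ j ih =>
    rw [genFun_setS_succ hk (by omega) hj, ih (by omega), qPoch, qPoch, Finset.prod_range_succ,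
      qpow_pow]
    have h : qpow (-2 * ((N 1 : ℤ) - ((j + 1 : ℕ) : ℤ))) =
        qpow (2 - 2 * (N 1 : ℤ)) * qpow (2 * (j : ℤ)) := by
      rw [← qpow_add]
      congr 1
      push_cast
      ring
    rw [h]
    ring

end GollnitzGordon

theorem mainTheorem5 (k i : ℕ) (hi : 1 ≤ i) (hik : i ≤ k) (N : ℕ → ℕ)
    (hN : ∀ r, 1 ≤ r → r + 1 < k → N (r + 1) ≤ N r) (hN0 : ∀ r, k ≤ r → N r = 0) :
    (∃ Φ : GollnitzGordon.setF k i N ≃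
        GollnitzGordon.setR ((N 1 : ℤ) - 1) × GollnitzGordon.setG k i N,
      ∀ lam : GollnitzGordon.setF k i N,
        (lam.1.size : ℤ) = (∑ x ∈ (Φ lam).1.1, x) + ((Φ lam).2.1.size : ℤ)) ∧
    GollnitzGordon.genFun (GollnitzGordon.setF k i N) =
      GollnitzGordon.qPoch (-GollnitzGordon.qpow (2 - 2 * (N 1 : ℤ))) (GollnitzGordon.qpow 2)
          (N 1 - 1) *
        GollnitzGordon.genFun (GollnitzGordon.setG k i N) := by
  open GollnitzGordon in
  rcases Nat.eq_zero_or_pos (N 1) with h0 | hpos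
  · have hFG : setF k i N = setG k i N := by
      rcases Nat.lt_or_ge 1 k with hk | hk
      · exact setF_eq_setG_of_zero hk h0
      · exact setF_eq_setG_of_k_le_one hk
    have hM : (N 1 : ℤ) - 1 ≤ 0 := by omega
    have hu : ∀ τ : setR ((N 1 : ℤ) - 1), τ.1 = ∅ := fun τ => (mem_setR_of_nonpos hM).1 τ.2
    let u : Unique (setR ((N 1 : ℤ) - 1)) :=
      { default := ⟨∅, (mem_setR_of_nonpos hM).2 rfl⟩
        uniq := fun τ => Subtype.ext (hu τ) }
    refine ⟨⟨(Equiv.setCongr hFG).trans (Equiv.uniqueProd _ _).symm, fun lam => ?_⟩, ?_⟩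
    · rw [hu, Finset.sum_empty, zero_add]
      rfl
    · rw [h0, hFG, qPoch, Nat.zero_sub, Finset.prod_range_zero, one_mul]
  · have hk : 2 ≤ k := by
      by_contra hk
      have := hN0 1 (by omega)
      omega
    constructor
    · have h := exists_equiv_prod (i := i) (N := N) hk (N 1 - 1) 1 le_rfl (by omega)
      rw [setS_one, show ((N 1 - 1 : ℕ) : ℤ) = (N 1 : ℤ) - 1 by omega] at h
      obtain ⟨Φ, hΦ⟩ := h
      refine ⟨Φ.symm, fun lam => ?_⟩
      rw [← hΦ, Equiv.apply_symm_apply]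
    · rw [← setS_total hk, ← genFun_setS hk (N 1 - 1) (by omega), Nat.sub_add_cancel hpos]
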